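/- For $n\ge 2$ let $B_n=\langle\sigma_1,\dots,\sigma_{n-1}\mid \sigma_i\sigma_j=\sigma_j\sigma_i\ (|i-j|\ge2),\ \sigma_i\sigma_j\sigma_i=\sigma_j\sigma_i\sigma_j\ (|i-j|=1)\rangle$ be the $n$-strand braid group. For $1\le p<q\le n$ put $a_{p,q}=\sigma_p\cdots\sigma_{q-2}\,\sigma_{q-1}\,\sigma_{q-2}^{-1}\cdots\sigma_p^{-1}$, and let the dual braid monoid $BKL_n$ be the submonoid of $B_n$ generated by all these $a_{p,q}$. Let $\delta_n=\sigma_1\sigma_2\cdots\sigma_{n-1}$ and $\phi_n(\beta)=\delta_n\beta\delta_n^{-1}$. For $n\ge3$ the homomorphism $B_{n-1}\to B_n$, $\sigma_i\mapsto\sigma_i$, induces the canonical homomorphism $\iota\colon BKL_{n-1}\to BKL_n$, which is suppressed from the notation in the next two paragraphs. Let $n\ge3$. The $BKL_{n-1}$-tail of $\beta\in BKL_n$ is the maximal (with respect to right divisibility) right divisor of $\beta$ lying in $BKL_{n-1}$. The $\phi_n$-splitting of a nontrivial $\beta\in BKL_n$ is the unique sequence $(\beta_b,\dots,\beta_1)$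 of elements of $BKL_{n-1}$ such that $\beta_b\ne1$, $\beta=\phi_n^{b-1}(\beta_b)\cdots\phi_n(\beta_2)\,\beta_1$, and, for each $1\le k\le b$, the $BKL_{n-1}$-tail of $\phi_n^{b-k}(\beta_b)\cdots\phi_n(\beta_{k+1})$ is trivial; the $\phi_n$-splitting of $1$ is the sequence $(1)$. The length $b$ of the splitting is the $n$-breadth of $\beta$. The rotating relation $<^*_n$ on $BKL_n$ is defined recursively. On $BKL_2$, $\beta<^*_2\gamma$ means $\beta=a_{1,2}^{b}$ and $\gamma=a_{1,2}^{c}$ with $b<c$. For $n\ge3$, $\beta<^*_n\gamma$ means that the $\phi_n$-splitting of $\beta$ is smaller than that of $\gamma$ in the ShortLex extension of $<^*_{n-1}$: it is shorter, or the lengths are equal and it is lexicographically smaller, reading from the left, that is, starting with $\beta_b$. Then the following hold. 1. For every $n\ge2$, $<^*_n$ is a well-ordering on $BKL_n$, and for each $\beta\in BKL_n$ the immediate $<^*_n$-successor of $\beta$ is $\beta\,a_{1,2}=\beta\,\sigma_1$. 2. For every $n\ge3$, the canonical homomorphism $\iota\colon BKL_{n-1}\to BKL_n$ is injective and satisfies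 $\iota(\beta)<^*_n\iota(\gamma)\iff\beta<^*_{n-1}\gamma$, and its image is the initial segment of $(BKL_n,<^*_n)$ determined by $a_{n-1,n}$, i.e. $BKL_{n-1}=\{\beta\in BKL_n\mid\beta<^*_n a_{n-1,n}\}$. Moreover, $a_{n-1,n}$ has $n$-breadth $2$ and is the $<^*_n$-smallest braid of $n$-breadth $2$. -/

import Mathlib

/-- The defining relations of Artin's `n`-strand braid group. The generators are indexed by the
integers `i` with `1 ≤ i ≤ n - 1`, and a relation `u = v` is encoded by the element `u * v⁻¹`. -/
inductive ArtinRel (n : ℕ) : FreeGroup {i : ℕ // 1 ≤ i ∧ i < n} → Prop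
  | comm (i j : {i : ℕ // 1 ≤ i ∧ i < n}) (h : i.1 + 2 ≤ j.1) :
      ArtinRel n (FreeGroup.of i * FreeGroup.of j *
        (FreeGroup.of j * FreeGroup.of i)⁻¹)
  | braid (i j : {i : ℕ // 1 ≤ i ∧ i < n}) (h : j.1 = i.1 + 1) :
      ArtinRel n (FreeGroup.of i * FreeGroup.of j * FreeGroup.of i *
        (FreeGroup.of j * FreeGroup.of i * FreeGroup.of j)⁻¹)

/-- Artin's braid group `B_n` on `n` strands, given by its presentation. -/
abbrev ArtinBraid (n : ℕ) : Type :=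
  PresentedGroup {r : FreeGroup {i : ℕ // 1 ≤ i ∧ i < n} | ArtinRel n r}

namespace ArtinBraid

/-- The generator `σ_i` of `B_n`, for `1 ≤ i ≤ n - 1` (and `1` for the other values of `i`, which
are never used). -/
def sigma (n i : ℕ) : ArtinBraid n :=
  if h : 1 ≤ i ∧ i < n then PresentedGroup.of ⟨i, h⟩ else 1

theorem sigma_comm (n : ℕ) {i j : ℕ} (hi : 1 ≤ i) (hij : i + 2 ≤ j) (hj : j < n) :
    sigma n i * sigma n j = sigma n j * sigma n i := by
  have h1 : 1 ≤ i ∧ i < n := ⟨hi, by omega⟩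
  have h2 : 1 ≤ j ∧ j < n := ⟨by omega, hj⟩
  have h := PresentedGroup.one_of_mem
    (rels := {r : FreeGroup {i : ℕ // 1 ≤ i ∧ i < n} | ArtinRel n r})
    (ArtinRel.comm ⟨i, h1⟩ ⟨j, h2⟩ hij)
  simp only [map_mul, map_inv] at h
  simp only [sigma, h1, h2, and_self, dif_pos]
  exact mul_inv_eq_one.1 h

theorem sigma_braid (n : ℕ) {i : ℕ} (hi : 1 ≤ i) (hj : i + 1 < n) :
    sigma n i * sigma n (i + 1) * sigma n i = sigma n (i + 1) * sigma n i * sigma n (i + 1) := by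
  have h1 : 1 ≤ i ∧ i < n := ⟨hi, by omega⟩
  have h2 : 1 ≤ i + 1 ∧ i + 1 < n := ⟨by omega, hj⟩
  have h := PresentedGroup.one_of_mem
    (rels := {r : FreeGroup {i : ℕ // 1 ≤ i ∧ i < n} | ArtinRel n r})
    (ArtinRel.braid ⟨i, h1⟩ ⟨i + 1, h2⟩ rfl)
  simp only [map_mul, map_inv] at h
  simp only [sigma, dif_pos h1, dif_pos h2]
  exact mul_inv_eq_one.1 h

/-- The canonical homomorphism `B_n → B_{n+1}`, which sends `σ_i` to `σ_i` for `1 ≤ i ≤ n - 1`. -/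
def incl (n : ℕ) : ArtinBraid n →* ArtinBraid (n + 1) :=
  PresentedGroup.toGroup (f := fun i => sigma (n + 1) i.1) (by
    intro r hr
    cases hr with
    | comm i j h =>
      simp only [map_mul, map_inv, FreeGroup.lift_apply_of]
      exact mul_inv_eq_one.2 (sigma_comm (n + 1) i.2.1 h (by have := j.2.2; omega))
    | braid i j h =>
      simp only [map_mul, map_inv, FreeGroup.lift_apply_of, h]
      exact mul_inv_eq_one.2
        (sigma_braid (n + 1) i.2.1 (by have := j.2.2; omega)))

theorem incl_sigma (n : ℕ) {i : ℕ} (h : 1 ≤ i ∧ i < n) :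
    incl n (sigma n i) = sigma (n + 1) i := by
  simp only [sigma, dif_pos h, incl]
  rw [PresentedGroup.toGroup.of]

/-- The braid `δ_{p,q} = σ_p σ_{p+1} ⋯ σ_{q-1}` of `B_n` (for `1 ≤ p ≤ q ≤ n`). -/
def delta (n p q : ℕ) : ArtinBraid n :=
  ((List.range' p (q - p)).map (sigma n)).prod

/-- The Birman-Ko-Lee generator
`a_{p,q} = σ_p ⋯ σ_{q-2} σ_{q-1} σ_{q-2}⁻¹ ⋯ σ_p⁻¹` of `B_n` (for `1 ≤ p < q ≤ n`). -/
def a (n p q : ℕ) : ArtinBraid n :=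
  delta n p (q - 1) * sigma n (q - 1) * (delta n p (q - 1))⁻¹

/-- The rotation automorphism `φ_n : β ↦ δ_n β δ_n⁻¹`, where `δ_n = σ_1 σ_2 ⋯ σ_{n-1}`. -/
def phi (n : ℕ) : MulAut (ArtinBraid n) :=
  MulAut.conj (delta n 1 n)

theorem incl_delta (n : ℕ) {p q : ℕ} (hp : 1 ≤ p) (hq : q ≤ n) :
    incl n (delta n p q) = delta (n + 1) p q := by
  simp only [delta, map_list_prod, List.map_map]
  congr 1
  apply List.map_congr_left
  intro i hi
  rw [List.mem_range'_1] at hi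
  exact incl_sigma n ⟨by omega, by omega⟩

theorem incl_a (n : ℕ) {p q : ℕ} (hp : 1 ≤ p) (hpq : p < q) (hq : q ≤ n) :
    incl n (a n p q) = a (n + 1) p q := by
  simp only [a, map_mul, map_inv]
  rw [incl_delta n hp (by omega), incl_sigma n ⟨by omega, by omega⟩]

end ArtinBraid

/-- The dual braid monoid `BKL_n`: the submonoid of `B_n` generated by the Birman-Ko-Lee generators
`a_{p,q}` with `1 ≤ p < q ≤ n`. -/
def BKL (n : ℕ) : Submonoid (ArtinBraid n) :=
  Submonoid.closure {β | ∃ p q : ℕ, 1 ≤ p ∧ p < q ∧ q ≤ n ∧ β = ArtinBraid.a n p q}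

namespace BKL

/-- The generator `a_{p,q}` as an element of `BKL_n`. -/
def gen (n p q : ℕ) (hp : 1 ≤ p) (hpq : p < q) (hq : q ≤ n) : BKL n :=
  ⟨ArtinBraid.a n p q, Submonoid.subset_closure ⟨p, q, hp, hpq, hq, rfl⟩⟩

theorem incl_mem (n : ℕ) (β : BKL n) : ArtinBraid.incl n β ∈ BKL (n + 1) := by
  suffices h : BKL n ≤ (BKL (n + 1)).comap (ArtinBraid.incl n) from h β.2
  refine Submonoid.closure_le.2 ?_
  rintro _ ⟨p, q, hp, hpq, hq, rfl⟩
  exact Submonoid.subset_closure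
    ⟨p, q, hp, hpq, by omega, ArtinBraid.incl_a n hp hpq hq⟩

/-- The canonical embedding of `BKL_n` into `BKL_{n+1}`, induced by `σ_i ↦ σ_i`. -/
def incl (n : ℕ) : BKL n →* BKL (n + 1) :=
  ((ArtinBraid.incl n).comp (BKL n).subtype).codRestrict (BKL (n + 1)) (incl_mem n)

/-- `RightDvd n α β`: the element `α` is a right divisor of `β` in the monoid `BKL_n`. Both
arguments are written as elements of the ambient group `B_n`. -/
def RightDvd (n : ℕ) (α β : ArtinBraid n) : Prop :=
  ∃ γ ∈ BKL n, β = γ * α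

/-- `IsTail n β τ`: the braid `τ` is the `BKL_n`-tail of the element `β` of `BKL_{n+1}`, i.e. the
maximal (for right divisibility) right divisor of `β` that lies in `BKL_n`. -/
def IsTail (n : ℕ) (β : ArtinBraid (n + 1)) (τ : BKL n) : Prop :=
  RightDvd (n + 1) (incl n τ) β ∧
    ∀ τ' : BKL n, RightDvd (n + 1) (incl n τ') β → RightDvd n τ' τ

/-- For a finite sequence `(β_b, …, β_1)` of elements of `BKL_n`, the braid
`φ^{b-1}(β_b) ⋯ φ(β_2) β_1` of `B_{n+1}`, where `φ = φ_{n+1}`. -/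
def rotProd (n : ℕ) : List (BKL n) → ArtinBraid (n + 1)
  | [] => 1
  | β :: s => (ArtinBraid.phi (n + 1) ^ s.length) (incl n β) * rotProd n s

/-- `IsSplitting n β s`: the sequence `s = (β_b, …, β_1)` of elements of `BKL_n` (listed in this
order) is the `φ_{n+1}`-splitting of the element `β` of `BKL_{n+1}`. This means that
* the sequence is nonempty, and its first entry `β_b` is not `1`, except that the
  splitting of the trivial braid is the sequence `(1)` of length one;
* `β = φ^{b-1}(β_b) ⋯ φ(β_2) β_1`;
* for `1 ≤ k ≤ b` the `BKL_n`-tail of `φ^{b-k}(β_b) ⋯ φ(β_{k+1})` is trivial; this braid is the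
  image under `φ` of the product associated with `(β_b, …, β_{k+1})`. -/
def IsSplitting (n : ℕ) (β : BKL (n + 1)) (s : List (BKL n)) : Prop :=
  s ≠ [] ∧ (s.head? = some 1 → s.length = 1) ∧
    (β : ArtinBraid (n + 1)) = rotProd n s ∧
    ∀ k : ℕ, 1 ≤ k → k ≤ s.length →
      IsTail n (ArtinBraid.phi (n + 1) (rotProd n (s.take (s.length - k)))) 1

/-- `HasBreadth n β b`: the element `β` of `BKL_{n+1}` has `(n+1)`-breadth `b`, i.e. its
`φ_{n+1}`-splitting has length `b`. -/
def HasBreadth (n : ℕ) (β : BKL (n + 1)) (b : ℕ) : Prop :=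
  ∃ s : List (BKL n), IsSplitting n β s ∧ s.length = b

/-- The rotating relation `<*_n` on `BKL_n`, for `n ≥ 2`. On `BKL_2` it compares the exponents of
`a_{1,2}`; on `BKL_n` with `n ≥ 3` it compares the `φ_n`-splittings in the ShortLex extension of the
relation on `BKL_{n-1}`. (The values for `n = 0` and `n = 1` are never used.) -/
def RotLT : (n : ℕ) → BKL n → BKL n → Prop
  | 0 => fun _ _ => False
  | 1 => fun _ _ => False
  | 2 => fun β γ => ∃ b c : ℕ, b < c ∧
      (β : ArtinBraid 2) = ArtinBraid.a 2 1 2 ^ b ∧ (γ : ArtinBraid 2) = ArtinBraid.a 2 1 2 ^ c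
  | n + 3 => fun β γ => ∃ s t : List (BKL (n + 2)),
      IsSplitting (n + 2) β s ∧ IsSplitting (n + 2) γ t ∧ List.Shortlex (RotLT (n + 2)) s t

end BKL

/-!
The dual generators `a_{p,q}` satisfy the Hurwitz relations of the transpositions lying below the
cycle `finRotate` in the absolute order of the symmetric group. The interval below this cycle is a
lattice (it consists of the noncrossing partitions), and `B_n` turns out to be its interval group,
with `BKL_n` as the monoid generated by the simple elements, that is, by the lifts of the interval.
This rests on an action on right-greedy normal sequences of simple elements, made invertible by
adjoining formal fractions: it shows that every element of the monoid has a greatest simple right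
divisor, and therefore, by induction on the length, a greatest right divisor in `BKL_{n-1}`.

At most two applications of `φ_n⁻¹` bring any generator into `BKL_{n-1}`, so peeling off tails
terminates and yields the `φ_n`-splitting; it is unique because tails are. Forgetting the last
strand shows that `ι` is injective. The rest is an induction on `n` using ShortLex: right
multiplication by `a_{1,2}` changes only the last entry `β_1` of a splitting, the splittings of
length one are those of `BKL_{n-1}`, and that of `a_{n-1,n}` is `(a_{n-2,n-1}, 1)`.
-/

/-- A conjugation-invariant length function on a group. The example to keep in mind is a symmetric
group, with the length given by the least number of transpositions in a factorization. -/
class AbsoluteLength (W : Type*) [Group W] where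
  /-- The length of an element. -/
  len : W → ℕ
  len_eq_zero_iff (a : W) : len a = 0 ↔ a = 1
  len_mul_le (a b : W) : len (a * b) ≤ len a + len b
  len_conj (g a : W) : len (g * a * g⁻¹) = len a

namespace AbsoluteLength

variable {W : Type*} [Group W] [AbsoluteLength W]

/-- The absolute order: `a ≼ b` if `a` is a right divisor of `b` and the lengths of `a` and of the
quotient `b * a⁻¹` add up to that of `b`. -/
def Le (a b : W) : Prop := len (b * a⁻¹) + len a = len b

end AbsoluteLength

infix:50 " ≼ " => AbsoluteLength.Le

namespace AbsoluteLength

variable {W : Type*} [Group W] [AbsoluteLength W] {a b c d r s x y : W}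

theorem len_one : len (1 : W) = 0 := (len_eq_zero_iff 1).2 rfl

theorem right_le_mul_iff : b ≼ a * b ↔ len (a * b) = len a + len b := by
  rw [Le, mul_inv_cancel_right]
  exact eq_comm

theorem left_le_mul_iff : a ≼ a * b ↔ len (a * b) = len a + len b := by
  rw [Le, len_conj, add_comm]
  exact eq_comm

theorem left_le_mul_iff_right_le_mul : a ≼ a * b ↔ b ≼ a * b :=
  left_le_mul_iff.trans right_le_mul_iff.symm

theorem Le.refl (a : W) : a ≼ a := by rw [Le, mul_inv_cancel, len_one, zero_add]

theorem one_le (a : W) : 1 ≼ a := by rw [Le, inv_one, mul_one, len_one, add_zero]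

theorem Le.len_le (h : a ≼ b) : len a ≤ len b := h ▸ Nat.le_add_left _ _

theorem Le.eq_of_len_le (h : a ≼ b) (hlen : len b ≤ len a) : a = b := by
  have h0 : len (b * a⁻¹) = 0 := by
    unfold Le at h
    omega
  exact (mul_inv_eq_one.1 ((len_eq_zero_iff _).1 h0)).symm

theorem Le.antisymm (h : a ≼ b) (h' : b ≼ a) : a = b := h.eq_of_len_le h'.len_le

theorem Le.eq_one (h : a ≼ 1) : a = 1 := h.antisymm (one_le a)

theorem eq_of_forall_le_iff (h : ∀ x, x ≼ a ↔ x ≼ b) : a = b :=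
  ((h a).1 (Le.refl a)).antisymm ((h b).2 (Le.refl b))

theorem mul_le_mul_assoc :
    (r ≼ x * r ∧ x * r ≼ y * (x * r)) ↔ (x ≼ y * x ∧ r ≼ y * x * r) := by
  simp only [right_le_mul_iff]
  have := len_mul_le y (x * r)
  have := len_mul_le x r
  have := len_mul_le (y * x) r
  have := len_mul_le y x
  rw [← mul_assoc y x r] at *
  omega

theorem Le.trans (h : a ≼ b) (h' : b ≼ c) : a ≼ c := by
  have h₁ : a ≼ b * a⁻¹ * a ∧ b * a⁻¹ * a ≼ c * b⁻¹ * (b * a⁻¹ * a) := by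
    simpa only [inv_mul_cancel_right] using ⟨h, h'⟩
  simpa only [mul_assoc, inv_mul_cancel_left, inv_mul_cancel, mul_one] using
    (mul_le_mul_assoc.1 h₁).2

theorem le_mul_inv_iff (h : s ≼ d) : x ≼ d * s⁻¹ ↔ s ≼ x * s ∧ x * s ≼ d := by
  have key := mul_le_mul_assoc (r := s) (x := x) (y := d * s⁻¹ * x⁻¹)
  rw [← mul_assoc _ x s, inv_mul_cancel_right, inv_mul_cancel_right] at key
  simp only [key, h, and_true]

theorem le_iff_mul_le_mul (h : r ≼ a * r) : x ≼ a ↔ r ≼ x * r ∧ x * r ≼ a * r := by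
  rw [← le_mul_inv_iff h, mul_inv_cancel_right]

theorem Le.mul_inv_le (h : a ≼ b) : b * a⁻¹ ≼ b := by
  have h' := (left_le_mul_iff_right_le_mul (a := b * a⁻¹) (b := a)).2
  rw [inv_mul_cancel_right] at h'
  exact h' h

theorem Le.conj (h : a ≼ b) (g : W) : g * a * g⁻¹ ≼ g * b * g⁻¹ := by
  rwa [Le, len_conj, len_conj, show g * b * g⁻¹ * (g * a * g⁻¹)⁻¹ = g * (b * a⁻¹) * g⁻¹ by group,
    len_conj]

theorem le_conj_iff {g : W} : x ≼ g * a * g⁻¹ ↔ g⁻¹ * x * g ≼ a := by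
  constructor <;> intro hx
  · simpa [mul_assoc] using hx.conj g⁻¹
  · simpa [mul_assoc] using hx.conj g

theorem Le.conj_self (h : a ≼ c) : c * a * c⁻¹ ≼ c := by
  simpa only [mul_inv_cancel_right] using h.conj c

theorem Le.inv_mul_le (h : a ≼ b) : a⁻¹ * b ≼ b := by
  simpa [mul_assoc] using h.mul_inv_le.conj b⁻¹

theorem Le.mul_inv_le_mul_inv (h : a ≼ b) (h' : b ≼ c) : b * a⁻¹ ≼ c * a⁻¹ := by
  rw [le_mul_inv_iff (h.trans h'), inv_mul_cancel_right]
  exact ⟨h, h'⟩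

theorem Le.of_mul_inv_le (h : a * s⁻¹ ≼ b * s⁻¹) (hs : s ≼ b) : a ≼ b := by
  simpa only [inv_mul_cancel_right] using ((le_mul_inv_iff hs).1 h).2

/-- Two elements without a nontrivial common lower bound in the absolute order. -/
def Coprime (a b : W) : Prop := ∀ x, x ≼ a → x ≼ b → x = 1

theorem Coprime.conj (h : Coprime a b) (g : W) : Coprime (g * a * g⁻¹) (g * b * g⁻¹) := by
  intro x ha hb
  have hx := h _ (le_conj_iff.1 ha) (le_conj_iff.1 hb)
  rwa [mul_eq_one_iff_eq_inv, mul_eq_left] at hx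

/-- Any two elements below `c` in the absolute order have a greatest lower bound. -/
class HasMeets (c : W) : Prop where
  exists_meet {a b : W} (ha : a ≼ c) (hb : b ≼ c) : ∃ m, ∀ x, x ≼ m ↔ x ≼ a ∧ x ≼ b

open Classical in
/-- The greatest lower bound of two elements (by convention `1` if it does not exist). -/
noncomputable def meet (a b : W) : W :=
  if h : ∃ m, ∀ x, x ≼ m ↔ x ≼ a ∧ x ≼ b then h.choose else 1

section Meets

variable [HasMeets c]

theorem le_meet_iff (ha : a ≼ c) (hb : b ≼ c) : x ≼ meet a b ↔ x ≼ a ∧ x ≼ b := by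
  have h := HasMeets.exists_meet ha hb
  rw [meet, dif_pos h]
  exact h.choose_spec x

theorem meet_le_left (ha : a ≼ c) (hb : b ≼ c) : meet a b ≼ a :=
  ((le_meet_iff ha hb).1 (Le.refl _)).1

theorem meet_le_right (ha : a ≼ c) (hb : b ≼ c) : meet a b ≼ b :=
  ((le_meet_iff ha hb).1 (Le.refl _)).2

theorem Coprime.le_of_le_mul (h : Coprime a (d * r⁻¹)) (har : a * r ≼ c) (hd : d ≼ c)
    (hr : r ≼ a * r) (hrd : r ≼ d) (hx : x ≼ a * r) (hxd : x ≼ d) : x ≼ r := by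
  have hrm : r ≼ meet (a * r) d := (le_meet_iff har hd).2 ⟨hr, hrd⟩
  have hm : meet (a * r) d * r⁻¹ = 1 := by
    apply h
    · simpa only [mul_inv_cancel_right] using hrm.mul_inv_le_mul_inv (meet_le_left har hd)
    · exact hrm.mul_inv_le_mul_inv (meet_le_right har hd)
  rw [← mul_inv_eq_one.1 hm]
  exact (le_meet_iff har hd).2 ⟨hx, hxd⟩

end Meets

section Absorbed

variable {q u : W} [HasMeets c]

/-- The largest right divisor `x` of `u` such that `x * s` is a reduced product below `c`. -/
noncomputable def absorbed (c u s : W) : W := meet u (c * s⁻¹)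

theorem le_absorbed_iff (hu : u ≼ c) (hs : s ≼ c) :
    x ≼ absorbed c u s ↔ x ≼ u ∧ s ≼ x * s ∧ x * s ≼ c := by
  rw [absorbed, le_meet_iff hu hs.mul_inv_le, le_mul_inv_iff hs]

theorem absorbed_le (hu : u ≼ c) (hs : s ≼ c) : absorbed c u s ≼ u :=
  ((le_absorbed_iff hu hs).1 (Le.refl _)).1

theorem le_absorbed_mul (hu : u ≼ c) (hs : s ≼ c) : s ≼ absorbed c u s * s :=
  ((le_absorbed_iff hu hs).1 (Le.refl _)).2.1

theorem absorbed_mul_le (hu : u ≼ c) (hs : s ≼ c) : absorbed c u s * s ≼ c :=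
  ((le_absorbed_iff hu hs).1 (Le.refl _)).2.2

theorem absorbed_eq_one (h : Coprime u (c * s⁻¹)) (hu : u ≼ c) (hs : s ≼ c) :
    absorbed c u s = 1 :=
  h _ (meet_le_left hu hs.mul_inv_le) (meet_le_right hu hs.mul_inv_le)

theorem absorbed_conj (hu : u ≼ c) (hs : s ≼ c) :
    absorbed c (c * u * c⁻¹) (c * s * c⁻¹) = c * absorbed c u s * c⁻¹ := by
  refine eq_of_forall_le_iff fun x => ?_
  rw [absorbed, le_meet_iff hu.conj_self hs.conj_self.mul_inv_le, le_conj_iff, le_conj_iff,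
    absorbed, le_meet_iff hu hs.mul_inv_le, ← le_conj_iff (x := x) (a := c * s⁻¹)]
  simp only [mul_inv_rev, inv_inv, mul_assoc]

theorem absorbed_mul_le_absorbed (hu : u ≼ c) (hq : q ≼ r * q) (hrq : r * q ≼ c) :
    absorbed c u (r * q) ≼ absorbed c u r := by
  have hr : r ≼ c := (left_le_mul_iff_right_le_mul.2 hq).trans hrq
  obtain ⟨hr', hq'⟩ := mul_le_mul_assoc.1 ⟨hq, le_absorbed_mul hu hrq⟩
  refine (le_absorbed_iff hu hr).2 ⟨absorbed_le hu hrq, hr', ?_⟩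
  refine (left_le_mul_iff_right_le_mul.2 hq').trans ?_
  rw [mul_assoc]
  exact absorbed_mul_le hu hrq

theorem absorbed_absorbed_mul (hu : u ≼ c) (hq : q ≼ r * q) (hrq : r * q ≼ c) :
    absorbed c (absorbed c u r * r) q = absorbed c u (r * q) * r := by
  have hr : r ≼ c := (left_le_mul_iff_right_le_mul.2 hq).trans hrq
  have hxr := le_absorbed_mul hu hr
  have hxr' := absorbed_mul_le hu hr
  obtain ⟨hzr, hzq⟩ := mul_le_mul_assoc.1 ⟨hq, le_absorbed_mul hu hrq⟩
  apply Le.antisymm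
  · have hrw : r ≼ absorbed c (absorbed c u r * r) q :=
      (le_absorbed_iff hxr' (hq.trans hrq)).2 ⟨hxr, hq, hrq⟩
    obtain ⟨hw, hw', hw''⟩ := (le_absorbed_iff hxr' (hq.trans hrq)).1 (Le.refl _)
    generalize absorbed c (absorbed c u r * r) q = w at *
    obtain ⟨v, rfl⟩ : ∃ v, w = v * r := ⟨w * r⁻¹, (inv_mul_cancel_right w r).symm⟩
    have hvu : v ≼ u := ((le_iff_mul_le_mul hxr).2 ⟨hrw, hw⟩).trans (absorbed_le hu hr)
    have hv : v ≼ absorbed c u (r * q) :=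
      (le_absorbed_iff hu hrq).2 ⟨hvu, (mul_le_mul_assoc.2 ⟨hrw, hw'⟩).2, by rwa [← mul_assoc]⟩
    exact ((le_iff_mul_le_mul hzr).1 hv).2
  · refine (le_absorbed_iff hxr' (hq.trans hrq)).2 ⟨?_, hzq, ?_⟩
    · exact ((le_iff_mul_le_mul hxr).1 (absorbed_mul_le_absorbed hu hq hrq)).2
    · rw [mul_assoc]
      exact absorbed_mul_le hu hrq

end Absorbed

/-- The right greedy normal sequences of elements below `c`: they stand for the formal products
`⋯ * seq 2 * seq 1 * seq 0`, in which no entry has a nontrivial right divisor that could be moved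
into the next one. -/
@[ext]
structure NormalSeq (c : W) where
  /-- The entries of the sequence, numbered from the right. -/
  seq : ℕ → W
  seq_le (k : ℕ) : seq k ≼ c
  coprime (k : ℕ) : Coprime (seq (k + 1)) (c * (seq k)⁻¹)

namespace NormalSeq

/-- The carries when the formal product `⋯ * u 1 * u 0` is multiplied by `s` on the right: the
carry into position `k + 1` is what the entry `u k` loses when it absorbs the carry into
position `k`. -/
noncomputable def carry (c : W) (u : ℕ → W) (s : W) : ℕ → W
  | 0 => s
  | k + 1 => u k * (absorbed c (u k) (carry c u s k))⁻¹

variable [HasMeets c] {t : W}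

theorem carry_le {u : ℕ → W} (hu : ∀ k, u k ≼ c) (hs : s ≼ c) (k : ℕ) : carry c u s k ≼ c := by
  induction k with
  | zero => exact hs
  | succ k ih => exact (absorbed_le (hu k) ih).mul_inv_le.trans (hu k)

theorem coprime_absorbed_mul {u v : W} (hu : u ≼ c) (hv : v ≼ c) (hr : r ≼ c)
    (h : Coprime v (c * u⁻¹)) :
    Coprime (absorbed c v (u * (absorbed c u r)⁻¹) * (u * (absorbed c u r)⁻¹))
      (c * (absorbed c u r * r)⁻¹) := by
  intro y hy hy'
  have hx := absorbed_le hu hr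
  have hxr := le_absorbed_mul hu hr
  obtain ⟨hxy, hyc⟩ := (le_mul_inv_iff (absorbed_mul_le hu hr)).1 hy'
  obtain ⟨hxy, hry⟩ := mul_le_mul_assoc.1 ⟨hxr, hxy⟩
  rw [← mul_assoc] at hyc
  have hsucc : u * (absorbed c u r)⁻¹ ≼ c := hx.mul_inv_le.trans hu
  have hyu : y ≼ u * (absorbed c u r)⁻¹ := by
    refine Coprime.le_of_le_mul (d := c * (absorbed c u r)⁻¹) (fun w hw hw' => ?_)
      (absorbed_mul_le hv hsucc) (hx.trans hu).mul_inv_le (le_absorbed_mul hv hsucc)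
      (hx.mul_inv_le_mul_inv hu) hy ?_
    · refine h w (hw.trans (absorbed_le hv hsucc)) ?_
      simpa [mul_assoc] using hw'
    · exact (le_mul_inv_iff (hx.trans hu)).2
        ⟨hxy, (left_le_mul_iff_right_le_mul.2 hry).trans hyc⟩
  have hyx : y * absorbed c u r ≼ absorbed c u r :=
    (le_absorbed_iff hu hr).2 ⟨((le_mul_inv_iff hx).1 hyu).2, hry, hyc⟩
  exact mul_eq_right.1 (hyx.antisymm hxy)

/-- Right multiplication of a normal sequence by an element below `c`. -/
noncomputable def act (U : NormalSeq c) (s : W) (hs : s ≼ c) : NormalSeq c where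
  seq k := absorbed c (U.seq k) (carry c U.seq s k) * carry c U.seq s k
  seq_le k := absorbed_mul_le (U.seq_le k) (carry_le U.seq_le hs k)
  coprime k := coprime_absorbed_mul (U.seq_le k) (U.seq_le (k + 1)) (carry_le U.seq_le hs k)
    (U.coprime k)

theorem act_seq (U : NormalSeq c) (hs : s ≼ c) (k : ℕ) :
    (act U s hs).seq k = absorbed c (U.seq k) (carry c U.seq s k) * carry c U.seq s k := rfl

theorem carry_mul (U : NormalSeq c) (hst : s ≼ t * s) (hc : t * s ≼ c) (ht : t ≼ c) (k : ℕ) :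
    carry c U.seq (t * s) k = carry c U.seq t k * carry c (act U t ht).seq s k ∧
      carry c (act U t ht).seq s k ≼ carry c U.seq (t * s) k := by
  induction k with
  | zero => exact ⟨rfl, hst⟩
  | succ k ih =>
    obtain ⟨heq, hle⟩ := ih
    have hck := carry_le U.seq_le hc k
    rw [heq] at hle hck
    have hsucc : carry c (act U t ht).seq s (k + 1) =
        absorbed c (U.seq k) (carry c U.seq t k) *
          (absorbed c (U.seq k) (carry c U.seq (t * s) k))⁻¹ := by
      rw [carry, act_seq, absorbed_absorbed_mul (U.seq_le k) hle hck, heq]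
      group
    rw [hsucc]
    refine ⟨by simp only [carry]; group, ?_⟩
    rw [carry, heq]
    exact (absorbed_mul_le_absorbed (U.seq_le k) hle hck).mul_inv_le_mul_inv
      (absorbed_le (U.seq_le k) (carry_le U.seq_le ht k))

theorem act_act (U : NormalSeq c) (hst : s ≼ t * s) (hc : t * s ≼ c) (ht : t ≼ c) (hs : s ≼ c) :
    act (act U t ht) s hs = act U (t * s) hc := by
  ext k
  obtain ⟨heq, hle⟩ := carry_mul U hst hc ht k
  have hck := carry_le U.seq_le hc k
  rw [heq] at hle hck
  rw [act_seq _ hs, act_seq U ht, absorbed_absorbed_mul (U.seq_le k) hle hck, act_seq U hc, heq,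
    mul_assoc]

theorem act_top_seq_succ (U : NormalSeq c) (k : ℕ) :
    (act U c (Le.refl c)).seq (k + 1) = U.seq k := by
  have absorbed_succ (k : ℕ) : absorbed c (U.seq (k + 1)) (U.seq k) = 1 :=
    absorbed_eq_one (U.coprime k) (U.seq_le _) (U.seq_le _)
  have carry_succ (k : ℕ) : carry c U.seq c (k + 1) = U.seq k := by
    induction k with
    | zero =>
      have h : absorbed c (U.seq 0) c = 1 := by
        refine absorbed_eq_one (fun x _ hx => Le.eq_one ?_) (U.seq_le 0) (Le.refl c)
        rwa [mul_inv_cancel] at hx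
      rw [carry, carry, h, inv_one, mul_one]
    | succ k ih => rw [carry, ih, absorbed_succ, inv_one, mul_one]
  rw [act_seq, carry_succ, absorbed_succ, one_mul]

theorem act_top_injective : Function.Injective fun U : NormalSeq c => act U c (Le.refl c) := by
  intro U V h
  ext k
  rw [← act_top_seq_succ U, ← act_top_seq_succ V]
  exact congrArg (fun X : NormalSeq c => X.seq (k + 1)) h

theorem act_mul_inv_act (U : NormalSeq c) (hs : s ≼ c) :
    act (act U (c * s⁻¹) hs.mul_inv_le) s hs = act U c (Le.refl c) := by
  rw [act_act U] <;> simp only [inv_mul_cancel_right, hs, Le.refl]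

theorem act_act_inv_mul (U : NormalSeq c) (hs : s ≼ c) :
    act (act U s hs) (s⁻¹ * c) hs.inv_mul_le = act U c (Le.refl c) := by
  rw [act_act U] <;> simp only [mul_inv_cancel_left, hs.inv_mul_le, Le.refl]

theorem act_injective (hs : s ≼ c) : Function.Injective fun U : NormalSeq c => act U s hs := by
  intro U V (h : act U s hs = act V s hs)
  refine act_top_injective ?_
  simp only [← act_act_inv_mul _ hs, h]

theorem act_top_act (U : NormalSeq c) (hs : s ≼ c) :
    act (act U c (Le.refl c)) s hs = act (act U (c * s * c⁻¹) hs.conj_self) c (Le.refl c) := by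
  have h := act_act_inv_mul U hs.conj_self
  simp only [mul_inv_rev, inv_inv, mul_assoc, inv_mul_cancel, mul_one] at h
  simp only [← h, act_mul_inv_act, mul_assoc]

omit [HasMeets c] in
/-- The entrywise conjugate of a normal sequence by `c`. -/
noncomputable def conj (U : NormalSeq c) : NormalSeq c where
  seq k := c * U.seq k * c⁻¹
  seq_le k := (U.seq_le k).conj_self
  coprime k := by
    simpa only [mul_inv_rev, inv_inv, mul_assoc] using (U.coprime k).conj c

omit [HasMeets c] in
theorem conj_seq (U : NormalSeq c) (k : ℕ) : U.conj.seq k = c * U.seq k * c⁻¹ := rfl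

omit [HasMeets c] in
theorem conj_injective : Function.Injective (conj : NormalSeq c → NormalSeq c) := by
  intro U V h
  ext k
  simpa only [conj_seq, mul_right_inj, mul_left_inj] using congrFun (congrArg seq h) k

theorem carry_conj (U : NormalSeq c) (hs : s ≼ c) (k : ℕ) :
    carry c U.conj.seq (c * s * c⁻¹) k = c * carry c U.seq s k * c⁻¹ := by
  induction k with
  | zero => rfl
  | succ k ih =>
    rw [carry, ih, conj_seq, absorbed_conj (U.seq_le k) (carry_le U.seq_le hs k), carry]
    group

theorem act_conj (U : NormalSeq c) (hs : s ≼ c) :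
    act U.conj (c * s * c⁻¹) hs.conj_self = (act U s hs).conj := by
  ext k
  rw [act_seq, conj_seq, conj_seq, act_seq, carry_conj U hs,
    absorbed_conj (U.seq_le k) (carry_le U.seq_le hs k)]
  group

/-- Left multiplication of a normal sequence by `c`. It is obtained by moving `c` through the
formal product, which conjugates the entries. -/
noncomputable def topMul (U : NormalSeq c) : NormalSeq c := act U.conj c (Le.refl c)

theorem topMul_injective : Function.Injective (topMul : NormalSeq c → NormalSeq c) :=
  act_top_injective.comp conj_injective

theorem act_commute_topMul (hs : s ≼ c) :
    Function.Commute (fun U : NormalSeq c => act U s hs) topMul := by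
  intro U
  simp only [topMul, act_top_act, act_conj U hs]

theorem exists_act_eq_topMul (V : NormalSeq c) (hs : s ≼ c) : ∃ U, act U s hs = topMul V :=
  ⟨act V.conj (c * s⁻¹) hs.mul_inv_le, act_mul_inv_act V.conj hs⟩

end NormalSeq

end AbsoluteLength

section Telescope

variable {X : Type*} {D : X → X}

/-- The equivalence of the formal fractions `D⁻ᵃ U` for an injective self-map `D`. -/
def telescopeSetoid (hD : Function.Injective D) : Setoid (ℕ × X) where
  r x y := D^[y.1] x.2 = D^[x.1] y.2
  iseqv :=
    { refl := fun _ => rfl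
      symm := fun h => h.symm
      trans := by
        rintro ⟨a, U⟩ ⟨b, V⟩ ⟨d, X⟩ h h'
        simp only at h h' ⊢
        apply hD.iterate b
        rw [← Function.iterate_add_apply, add_comm, Function.iterate_add_apply, h,
          ← Function.iterate_add_apply, add_comm, Function.iterate_add_apply, h',
          ← Function.iterate_add_apply, add_comm, Function.iterate_add_apply] }

/-- The mapping telescope of an injective self-map `D : X → X`: the extension of `X` by formal
fractions `D⁻ᵃ U` on which `D` becomes bijective. -/
def Telescope (hD : Function.Injective D) : Type _ := Quotient (telescopeSetoid hD)

namespace Telescope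

variable {hD : Function.Injective D}

/-- The embedding of a set into its telescope. -/
def of (U : X) : Telescope hD := Quotient.mk (telescopeSetoid hD) (0, U)

theorem of_injective : Function.Injective (of : X → Telescope hD) :=
  fun _ _ h => Quotient.exact h

/-- The extension to the telescope of a map that commutes with `D`. -/
def map (f : X → X) (hf : Function.Commute f D) : Telescope hD → Telescope hD :=
  Quotient.map (fun x => (x.1, f x.2)) (by
    rintro ⟨a, U⟩ ⟨b, V⟩ (h : D^[b] U = D^[a] V)
    change D^[b] (f U) = D^[a] (f V)
    rw [← (hf.iterate_right b).eq, ← (hf.iterate_right a).eq, h])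

theorem map_map {f g h : X → X} (hf : Function.Commute f D) (hg : Function.Commute g D)
    (hh : Function.Commute h D) (hfg : ∀ U, f (g U) = h U) (x : Telescope hD) :
    map f hf (map g hg x) = map h hh x := by
  induction x using Quotient.inductionOn with
  | h x => exact congrArg (fun U => Quotient.mk (telescopeSetoid hD) (x.1, U)) (hfg x.2)

theorem map_bijective {f : X → X} (hf : Function.Commute f D) (hinj : Function.Injective f)
    (hsurj : ∀ V, ∃ U, f U = D V) :
    Function.Bijective (map f hf : Telescope hD → Telescope hD) := by
  constructor
  · intro x y
    refine Quotient.inductionOn₂ x y ?_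
    rintro ⟨a, U⟩ ⟨b, V⟩ h
    refine Quotient.sound (s := telescopeSetoid hD) ?_
    have hUV : D^[b] (f U) = D^[a] (f V) := Quotient.exact h
    rw [← (hf.iterate_right b).eq, ← (hf.iterate_right a).eq] at hUV
    exact hinj hUV
  · intro y
    refine Quotient.inductionOn y ?_
    rintro ⟨a, V⟩
    obtain ⟨U, hU⟩ := hsurj V
    refine ⟨Quotient.mk (telescopeSetoid hD) (a + 1, U),
      Quotient.sound (s := telescopeSetoid hD) ?_⟩
    change D^[a] (f U) = D^[a + 1] V
    rw [hU, Function.iterate_succ_apply]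

end Telescope

end Telescope

namespace AbsoluteLength

open MulOpposite

universe u v

variable {W : Type u} [Group W] [AbsoluteLength W] {c d s t w : W}

section FracSeq

variable [HasMeets c]

/-- The formal fractions `c⁻ᵃ U` of normal sequences `U`, on which right multiplication by an
element below `c` is a permutation. -/
abbrev FracSeq (c : W) [HasMeets c] : Type u :=
  Telescope (NormalSeq.topMul_injective (c := c))

open Classical in
/-- Right multiplication of formal fractions by an element below `c` (by convention the identity if
the element is not below `c`). -/
noncomputable def fracAct (c : W) [HasMeets c] (s : W) : Equiv.Perm (FracSeq c) :=
  if hs : s ≼ c then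
    Equiv.ofBijective _ (Telescope.map_bijective (NormalSeq.act_commute_topMul hs)
      (NormalSeq.act_injective hs) (NormalSeq.exists_act_eq_topMul · hs))
  else 1

theorem fracAct_apply (hs : s ≼ c) (x : FracSeq c) :
    fracAct c s x = Telescope.map _ (NormalSeq.act_commute_topMul hs) x := by
  rw [fracAct, dif_pos hs, Equiv.ofBijective_apply]

theorem fracAct_of (hs : s ≼ c) (U : NormalSeq c) :
    fracAct c s (Telescope.of U) = Telescope.of (U.act s hs) :=
  fracAct_apply hs _

end FracSeq

/-- A map that is multiplicative on the reduced products below `c`. -/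
def IsIntervalHom {M : Type*} [Mul M] (c : W) (F : W → M) : Prop :=
  ∀ ⦃y z : W⦄, z ≼ y * z → y * z ≼ c → F (y * z) = F y * F z

theorem isIntervalHom_fracAct [HasMeets c] :
    IsIntervalHom c fun s => op (fracAct c s) := by
  intro t s hs hc
  have ht : t ≼ c := (left_le_mul_iff_right_le_mul.2 hs).trans hc
  refine congrArg op (Equiv.ext fun x => ?_)
  change fracAct c (t * s) x = fracAct c s (fracAct c t x)
  rw [fracAct_apply hc, fracAct_apply (hs.trans hc), fracAct_apply ht,
    Telescope.map_map]
  exact fun U => NormalSeq.act_act U hs hc ht (hs.trans hc)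

theorem isIntervalHom_len : IsIntervalHom c fun s => Multiplicative.ofAdd (len s : ℤ) := by
  intro y z hz _
  beta_reduce
  rw [right_le_mul_iff.1 hz, Nat.cast_add, ofAdd_add]

/-- The elements `L w` with `w ≼ c` present the group `G`, the relations being the reduced products
below `c`. -/
structure IsIntervalGroup {G : Type v} [Group G] (c : W) (L : W → G) : Prop where
  isIntervalHom : IsIntervalHom c L
  exists_lift {H : Type u} [Group H] (F : W → H) (hF : IsIntervalHom c F) :
    ∃ f : G →* H, ∀ w, w ≼ c → f (L w) = F w

/-- The monoid of the simple elements below `d`. -/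
def simpleMonoid {G : Type*} [Group G] (L : W → G) (d : W) : Submonoid G :=
  Submonoid.closure (L '' {w | w ≼ d})

/-- The element `x` is a right divisor of `y`, with a quotient in the monoid `K`. -/
def IsRightDivisor {G : Type*} [Monoid G] (K : Submonoid G) (x y : G) : Prop :=
  ∃ z ∈ K, y = z * x

section RightDivisor

variable {G : Type*} [Monoid G] {K : Submonoid G} {x y z : G}

theorem IsRightDivisor.refl (x : G) : IsRightDivisor K x x := ⟨1, K.one_mem, (one_mul x).symm⟩

theorem IsRightDivisor.trans (h : IsRightDivisor K x y) (h' : IsRightDivisor K y z) :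
    IsRightDivisor K x z := by
  obtain ⟨a, ha, rfl⟩ := h
  obtain ⟨b, hb, rfl⟩ := h'
  exact ⟨b * a, K.mul_mem hb ha, (mul_assoc b a x).symm⟩

theorem isRightDivisor_mul_left (hx : x ∈ K) (y : G) : IsRightDivisor K y (x * y) :=
  ⟨x, hx, rfl⟩

theorem IsRightDivisor.mul_right (h : IsRightDivisor K x y) (z : G) :
    IsRightDivisor K (x * z) (y * z) := by
  obtain ⟨a, ha, rfl⟩ := h
  exact ⟨a, ha, mul_assoc a x z⟩

/-- The element `τ` is the greatest right divisor of `β` (with quotients in `M`) that lies in the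
submonoid `K`; the other right divisors of `β` in `K` divide `τ` with quotients in `K`. -/
structure IsMaxRightDivisor (K M : Submonoid G) (τ β : G) : Prop where
  mem : τ ∈ K
  isRightDivisor : IsRightDivisor M τ β
  of_isRightDivisor : ∀ x ∈ K, IsRightDivisor M x β → IsRightDivisor K x τ

end RightDivisor

section Group

variable {G : Type*} [Group G] {K M : Submonoid G} {b x y z β γ τ : G}

theorem IsRightDivisor.of_mul_right (h : IsRightDivisor K (x * z) (y * z)) :
    IsRightDivisor K x y := by
  simpa only [mul_inv_cancel_right] using h.mul_right z⁻¹

theorem IsMaxRightDivisor.mul_right (hτ : IsMaxRightDivisor K M τ γ) (hγ : γ ∈ M) (hb : b ∈ K)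
    (hz : IsMaxRightDivisor K M z (γ * b)) : IsMaxRightDivisor K M (τ * b) (γ * b) := by
  refine ⟨K.mul_mem hτ.mem hb, hτ.isRightDivisor.mul_right b, fun x hx hxγ => ?_⟩
  obtain ⟨e, he, rfl⟩ := hz.of_isRightDivisor b hb (isRightDivisor_mul_left hγ b)
  exact (hz.of_isRightDivisor x hx hxγ).trans
    ((hτ.of_isRightDivisor e he hz.isRightDivisor.of_mul_right).mul_right b)

end Group

section SimpleMonoid

variable {G : Type v} [Group G] {L : W → G} {x β : G}

theorem lift_mem_simpleMonoid (hw : w ≼ d) : L w ∈ simpleMonoid L d :=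
  Submonoid.subset_closure ⟨w, hw, rfl⟩

theorem simpleMonoid_mono (h : d ≼ c) : simpleMonoid L d ≤ simpleMonoid L c :=
  Submonoid.closure_mono (Set.image_mono fun _ hw => Le.trans hw h)

theorem IsIntervalHom.map_one {F : W → G} (hF : IsIntervalHom c F) : F 1 = 1 := by
  have h := hF (y := 1) (z := 1) (one_le _) (by rw [one_mul]; exact one_le c)
  rwa [one_mul, left_eq_mul] at h

theorem IsIntervalHom.map_mul_inv_mul {F : W → G} (hF : IsIntervalHom c F) (h : s ≼ w)
    (hw : w ≼ c) : F (w * s⁻¹) * F s = F w := by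
  rw [← hF (by rwa [inv_mul_cancel_right]) (by rwa [inv_mul_cancel_right]), inv_mul_cancel_right]

theorem IsIntervalHom.isRightDivisor (hL : IsIntervalHom c L) (h : s ≼ w) (hwd : w ≼ d)
    (hd : d ≼ c) : IsRightDivisor (simpleMonoid L d) (L s) (L w) :=
  ⟨L (w * s⁻¹), lift_mem_simpleMonoid (h.mul_inv_le.trans hwd),
    (hL.map_mul_inv_mul h (hwd.trans hd)).symm⟩

theorem IsIntervalHom.eq_one_or_exists_eq_mul (hL : IsIntervalHom c L)
    (hx : x ∈ simpleMonoid L d) :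
    x = 1 ∨ ∃ y ∈ simpleMonoid L d, ∃ s, s ≼ d ∧ s ≠ 1 ∧ x = y * L s := by
  induction hx using Submonoid.closure_induction_right with
  | one => exact Or.inl rfl
  | mul_right y hy z hz ih =>
    obtain ⟨s, hs, rfl⟩ := hz
    by_cases h : s = 1
    · rwa [h, hL.map_one, mul_one]
    · exact Or.inr ⟨y, hy, s, hs, h, rfl⟩

namespace IsIntervalGroup

theorem exists_degree (hL : IsIntervalGroup c L) :
    ∃ deg : G → ℕ, (∀ w, w ≼ c → deg (L w) = len w) ∧
      ∀ x ∈ simpleMonoid L c, ∀ y ∈ simpleMonoid L c, deg (x * y) = deg x + deg y := by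
  obtain ⟨f, hf⟩ := hL.exists_lift
    (fun w => ULift.up (Multiplicative.ofAdd (len w : ℤ)))
    fun y z hz hc => ULift.down_injective (isIntervalHom_len hz hc)
  have nonneg : ∀ x ∈ simpleMonoid L c, 0 ≤ (f x).down.toAdd := by
    intro x hx
    induction hx using Submonoid.closure_induction with
    | mem x hx =>
      obtain ⟨w, hw, rfl⟩ := hx
      simp only [hf w hw, toAdd_ofAdd, Nat.cast_nonneg]
    | one => simp only [map_one, ULift.one_down, toAdd_one, le_refl]
    | mul x y _ _ hx hy =>
      rw [map_mul, ULift.mul_down, toAdd_mul]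
      exact add_nonneg hx hy
  refine ⟨fun x => (f x).down.toAdd.toNat, fun w hw => ?_, fun x hx y hy => ?_⟩
  · simp only [hf w hw, toAdd_ofAdd, Int.toNat_natCast]
  · beta_reduce
    rw [map_mul, ULift.mul_down, toAdd_mul, Int.toNat_add (nonneg x hx) (nonneg y hy)]

variable [HasMeets c]

theorem exists_head (hL : IsIntervalGroup c L) (hβ : β ∈ simpleMonoid L c) :
    ∃ w, w ≼ c ∧ IsRightDivisor (simpleMonoid L c) (L w) β ∧
      ∀ s, s ≼ c → IsRightDivisor (simpleMonoid L c) (L s) β → s ≼ w := by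
  obtain ⟨ρ, hρ⟩ := hL.exists_lift _ isIntervalHom_fracAct
  let emptySeq : NormalSeq c := ⟨fun _ => 1, fun _ => one_le c, fun _ _ h _ => h.eq_one⟩
  have unop_apply {γ : G} {U : NormalSeq c} (hU : (ρ γ).unop (.of emptySeq) = .of U) {s : W}
      (hs : s ≼ c) : (ρ (γ * L s)).unop (.of emptySeq) = .of (U.act s hs) := by
    rw [map_mul, hρ s hs, unop_mul, unop_op, Equiv.Perm.mul_apply, hU, fracAct_of]
  have exists_normalForm : ∀ γ ∈ simpleMonoid L c, ∃ U : NormalSeq c,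
      (ρ γ).unop (.of emptySeq) = .of U ∧ IsRightDivisor (simpleMonoid L c) (L (U.seq 0)) γ := by
    intro γ hγ
    induction hγ using Submonoid.closure_induction_right with
    | one =>
      refine ⟨emptySeq, by rw [map_one, unop_one, Equiv.Perm.one_apply], ?_⟩
      rw [← hL.isIntervalHom.map_one]
      exact .refl _
    | mul_right γ _ z hz ih =>
      obtain ⟨s, hs, rfl⟩ := hz
      obtain ⟨U, hU, hdvd⟩ := ih
      refine ⟨U.act s hs, unop_apply hU hs, ?_⟩
      rw [NormalSeq.act_seq, NormalSeq.carry, hL.isIntervalHom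
        (le_absorbed_mul (U.seq_le 0) hs) (absorbed_mul_le (U.seq_le 0) hs)]
      exact ((hL.isIntervalHom.isRightDivisor (absorbed_le (U.seq_le 0) hs) (U.seq_le 0)
        (Le.refl c)).trans hdvd).mul_right _
  obtain ⟨U, hU, hdvd⟩ := exists_normalForm β hβ
  refine ⟨U.seq 0, U.seq_le 0, hdvd, ?_⟩
  rintro s hs ⟨γ, hγ, rfl⟩
  obtain ⟨V, hV, -⟩ := exists_normalForm γ hγ
  obtain rfl : V.act s hs = U := Telescope.of_injective ((unop_apply hV hs).symm.trans hU)
  exact le_absorbed_mul (V.seq_le 0) hs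

theorem exists_common_head (hL : IsIntervalGroup c L) (hd : d ≼ c) (hβ : β ∈ simpleMonoid L c) :
    ∃ m, m ≼ d ∧ IsRightDivisor (simpleMonoid L c) (L m) β ∧ ∀ y ∈ simpleMonoid L d,
      ∀ s, s ≼ d → IsRightDivisor (simpleMonoid L c) (y * L s) β → s ≼ m := by
  obtain ⟨w, hw, hwβ, hmax⟩ := hL.exists_head hβ
  refine ⟨meet w d, meet_le_right hw hd,
    (hL.isIntervalHom.isRightDivisor (meet_le_left hw hd) hw (Le.refl c)).trans hwβ,
    fun y hy s hs hys => (le_meet_iff hw hd).2 ⟨hmax s (hs.trans hd) ?_, hs⟩⟩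
  exact (isRightDivisor_mul_left (simpleMonoid_mono hd hy) _).trans hys

theorem exists_tail (hL : IsIntervalGroup c L) (hd : d ≼ c) (hβ : β ∈ simpleMonoid L c) :
    ∃ τ, IsMaxRightDivisor (simpleMonoid L d) (simpleMonoid L c) τ β := by
  obtain ⟨deg, deg_lift, deg_mul⟩ := hL.exists_degree
  have deg_lt {γ : G} (hγ : γ ∈ simpleMonoid L c) {s : W} (hs : s ≼ c) (hs1 : s ≠ 1) :
      deg γ < deg (γ * L s) := by
    have := (len_eq_zero_iff s).not.2 hs1
    rw [deg_mul γ hγ _ (lift_mem_simpleMonoid hs), deg_lift s hs]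
    omega
  induction h : deg β using Nat.strong_induction_on generalizing β with
  | _ k ih =>
    obtain ⟨m, hmd, hmβ, hm⟩ := hL.exists_common_head hd hβ
    by_cases hm1 : m = 1
    · refine ⟨1, Submonoid.one_mem _, ⟨β, hβ, (mul_one β).symm⟩, fun x hx hxβ => ?_⟩
      rcases hL.isIntervalHom.eq_one_or_exists_eq_mul hx with rfl | ⟨y, hy, s, hs, hs1, rfl⟩
      · exact .refl 1
      · exact absurd (hm1 ▸ hm y hy s hs hxβ).eq_one hs1
    obtain ⟨γ, hγ, rfl⟩ := hmβ
    obtain ⟨τ, hτ⟩ := ih _ (h ▸ deg_lt hγ (hmd.trans hd) hm1) hγ rfl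
    have lift_m_mem : L m ∈ simpleMonoid L d := lift_mem_simpleMonoid hmd
    refine ⟨τ * L m, Submonoid.mul_mem _ hτ.mem lift_m_mem, hτ.isRightDivisor.mul_right _,
      fun x hx hxβ => ?_⟩
    rcases hL.isIntervalHom.eq_one_or_exists_eq_mul hx with rfl | ⟨y, hy, s, hs, hs1, rfl⟩
    · exact ⟨_, Submonoid.mul_mem _ hτ.mem lift_m_mem, (mul_one _).symm⟩
    have hsm := hm y hy s hs hxβ
    have quot_mem : L (m * s⁻¹) ∈ simpleMonoid L d :=
      lift_mem_simpleMonoid (hsm.mul_inv_le.trans hmd)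
    have hγ' := Submonoid.mul_mem _ hγ (simpleMonoid_mono hd quot_mem)
    rw [← hL.isIntervalHom.map_mul_inv_mul hsm (hmd.trans hd), ← mul_assoc] at hxβ h ⊢
    obtain ⟨z, hz⟩ := ih _ (h ▸ deg_lt hγ' (hs.trans hd) hs1) hγ' rfl
    exact ((hτ.mul_right hγ quot_mem hz).of_isRightDivisor y hy hxβ.of_mul_right).mul_right _

end IsIntervalGroup

end SimpleMonoid

end AbsoluteLength

namespace AbsoluteLength

open Equiv

section FixSpace

open Module

variable {α : Type*} {a b w : Perm α} {p q r s : α}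

/-- The space of the rational functions that are invariant under a permutation. -/
def fixSpace (w : Perm α) : Submodule ℚ (α → ℚ) where
  carrier := {f | ∀ i, f (w i) = f i}
  add_mem' hf hg i := by rw [Pi.add_apply, Pi.add_apply, hf, hg]
  zero_mem' _ := rfl
  smul_mem' x f hf i := by rw [Pi.smul_apply, Pi.smul_apply, hf]

theorem mem_fixSpace {f : α → ℚ} : f ∈ fixSpace w ↔ ∀ i, f (w i) = f i := Iff.rfl

theorem fixSpace_inf_le_mul (a b : Perm α) : fixSpace a ⊓ fixSpace b ≤ fixSpace (a * b) := by
  rintro f ⟨ha, hb⟩ i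
  rw [Perm.mul_apply, ha, hb]

theorem fixSpace_conj (g a : Perm α) :
    fixSpace (g * a * g⁻¹) =
      (fixSpace a).comap (LinearEquiv.funCongrLeft ℚ ℚ g : (α → ℚ) →ₗ[ℚ] α → ℚ) := by
  ext f
  refine g.forall_congr_right.symm.trans (forall_congr' fun i => ?_)
  simp only [Perm.mul_apply, Perm.inv_def, symm_apply_apply, LinearEquiv.coe_coe,
    LinearEquiv.funCongrLeft_apply, LinearMap.funLeft_apply]

theorem apply_swap_eq [DecidableEq α] {f : α → ℚ} (h : f p = f q) (i : α) :
    f (swap p q i) = f i := by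
  rw [swap_apply_def]
  split_ifs with hp hq
  · rw [hp, h]
  · rw [hq, h]
  · rfl

theorem eq_one_of_fixSpace_eq_top (h : fixSpace w = ⊤) : w = 1 := by
  classical
  refine Equiv.ext fun i => ?_
  have hi := mem_fixSpace.1 (h ▸ Submodule.mem_top : Pi.single i (1 : ℚ) ∈ fixSpace w) i
  by_contra hne : w i ≠ i
  rw [Pi.single_eq_same, Pi.single_eq_of_ne hne] at hi
  exact zero_ne_one hi

theorem fixSpace_lt_swap_mul [DecidableEq α] (h : w p ≠ p) :
    fixSpace w < fixSpace (swap p (w p) * w) := by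
  refine lt_of_le_not_ge (fun f hf i => ?_) fun hle => ?_
  · rw [Perm.mul_apply, apply_swap_eq (hf p).symm, hf i]
  have hmem : Pi.single p (1 : ℚ) ∈ fixSpace (swap p (w p) * w) := by
    intro i
    rcases eq_or_ne i p with rfl | hi
    · rw [Perm.mul_apply, swap_apply_right]
    · have hne : (swap p (w p) * w) i ≠ p := fun hp => by
        rw [Perm.mul_apply, swap_apply_eq_iff, swap_apply_left] at hp
        exact hi (w.injective hp)
      rw [Pi.single_eq_of_ne hne, Pi.single_eq_of_ne hi]
  have hp := hle hmem p
  rw [Pi.single_eq_of_ne h, Pi.single_eq_same] at hp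
  exact zero_ne_one hp

theorem eq_of_sameCycle {β : Type*} {f : α → β} (hf : ∀ i, f (w i) = f i)
    (h : w.SameCycle p q) : f p = f q := by
  obtain ⟨k, rfl⟩ := h
  induction k using Int.induction_on with
  | zero => rfl
  | succ k ih => rwa [add_comm, zpow_add, zpow_one, Perm.mul_apply, hf]
  | pred k ih => rwa [← hf ((w ^ _) p), ← Perm.mul_apply, ← zpow_one_add, add_sub_cancel]

theorem sameCycle_iff_forall_mem_fixSpace :
    w.SameCycle p q ↔ ∀ f ∈ fixSpace w, f p = f q := by
  classical
  refine ⟨fun h f hf => eq_of_sameCycle hf h, fun h => ?_⟩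
  by_contra hn
  have hp := h (fun i => if w.SameCycle p i then 1 else 0) fun i => by
    simp only [Perm.sameCycle_apply_right]
  rw [if_pos (Perm.SameCycle.refl w p), if_neg hn] at hp
  exact one_ne_zero hp

theorem sameCycle_swap [DecidableEq α] (p q : α) : (swap p q).SameCycle p q :=
  ⟨1, by rw [zpow_one, swap_apply_left]⟩

theorem sameCycle_of_sameCycle_mul_swap [DecidableEq α] (hrs : w.SameCycle r s)
    (h : (w * swap r s).SameCycle p q) : w.SameCycle p q := by
  rw [sameCycle_iff_forall_mem_fixSpace] at *
  refine fun f hf => h f fun i => ?_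
  rw [Perm.mul_apply, hf, apply_swap_eq (hrs f hf)]

theorem sameCycle_mul_swap_or [DecidableEq α] (h : w.SameCycle p q)
    (hpq : ¬(w * swap r s).SameCycle p q) :
    (w * swap r s).SameCycle p r ∨ (w * swap r s).SameCycle p s := by
  by_contra! hn
  have hinv (i : α) : (w * swap r s).SameCycle p (w i) ↔ (w * swap r s).SameCycle p i := by
    rw [← swap_apply_self r s i, ← Perm.mul_apply w, Perm.sameCycle_apply_right, swap_apply_self,
      swap_apply_def]
    split_ifs with hr hs
    · rw [hr, iff_false_right hn.1]; exact hn.2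
    · rw [hs, iff_false_right hn.2]; exact hn.1
    · rfl
  exact hpq (eq_of_sameCycle (fun i => propext (hinv i)) h ▸ Perm.SameCycle.refl _ p)

theorem sameCycle_mul_swap_cases [DecidableEq α] (r s : α) (h : w.SameCycle p q) :
    (w * swap r s).SameCycle p q ∨
    ((w * swap r s).SameCycle p r ∧ (w * swap r s).SameCycle q s) ∨
    ((w * swap r s).SameCycle p s ∧ (w * swap r s).SameCycle q r) := by
  by_cases hpq : (w * swap r s).SameCycle p q
  · exact Or.inl hpq
  rcases sameCycle_mul_swap_or h hpq with hp | hp <;>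
    rcases sameCycle_mul_swap_or h.symm (mt Perm.SameCycle.symm hpq) with hq | hq
  · exact absurd (hp.trans hq.symm) hpq
  · exact Or.inr (Or.inl ⟨hp, hq⟩)
  · exact Or.inr (Or.inr ⟨hp, hq⟩)
  · exact absurd (hp.trans hq.symm) hpq

theorem sameCycle_mul_swap_of_not_sameCycle [DecidableEq α] (hpr : w.SameCycle p r)
    (hqs : w.SameCycle q s) (hpq : ¬w.SameCycle p q) : (w * swap q s).SameCycle p r := by
  rcases sameCycle_mul_swap_cases q s hpr with h | ⟨h, -⟩ | ⟨h, -⟩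
  · exact h
  · exact absurd (sameCycle_of_sameCycle_mul_swap hqs h) hpq
  · exact absurd ((sameCycle_of_sameCycle_mul_swap hqs h).trans hqs.symm) hpq

variable [Fintype α]

theorem finrank_fixSpace_le (w : Perm α) : finrank ℚ (fixSpace w) ≤ Fintype.card α := by
  rw [← finrank_fintype_fun_eq_card ℚ]
  exact Submodule.finrank_le _

theorem finrank_fixSpace_add_le (a b : Perm α) :
    finrank ℚ (fixSpace a) + finrank ℚ (fixSpace b) ≤
      Fintype.card α + finrank ℚ ↥(fixSpace a ⊓ fixSpace b) := by
  rw [← Submodule.finrank_sup_add_finrank_inf_eq, ← finrank_fintype_fun_eq_card ℚ]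
  exact Nat.add_le_add_right (Submodule.finrank_le _) _

/-- The absolute length of a permutation is the codimension of its space of invariant functions. -/
noncomputable instance : AbsoluteLength (Perm α) where
  len w := Fintype.card α - finrank ℚ (fixSpace w)
  len_eq_zero_iff w := by
    rw [tsub_eq_zero_iff_le]
    constructor
    · intro h
      rw [← finrank_fintype_fun_eq_card ℚ] at h
      exact eq_one_of_fixSpace_eq_top
        (Submodule.eq_top_of_finrank_eq (h.antisymm' (Submodule.finrank_le _)))
    · rintro rfl
      rw [show fixSpace (1 : Perm α) = ⊤ from eq_top_iff.2 fun f _ i => rfl, finrank_top,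
        finrank_fintype_fun_eq_card]
  len_mul_le a b := by
    have := finrank_fixSpace_add_le a b
    have := Submodule.finrank_mono (fixSpace_inf_le_mul a b)
    omega
  len_conj g a := by
    rw [fixSpace_conj, Submodule.comap_equiv_eq_map_symm, LinearEquiv.finrank_map_eq]

theorem len_add_finrank_fixSpace (w : Perm α) :
    len w + finrank ℚ (fixSpace w) = Fintype.card α :=
  Nat.sub_add_cancel (finrank_fixSpace_le w)

theorem fixSpace_mul_of_len_eq (h : len (a * b) = len a + len b) :
    fixSpace (a * b) = fixSpace a ⊓ fixSpace b := by
  refine (Submodule.eq_of_le_of_finrank_le (fixSpace_inf_le_mul a b) ?_).symm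
  have := finrank_fixSpace_add_le a b
  have := len_add_finrank_fixSpace a
  have := len_add_finrank_fixSpace b
  have := len_add_finrank_fixSpace (a * b)
  omega

theorem Le.fixSpace_le (h : a ≼ b) : fixSpace b ≤ fixSpace a := by
  have hab := fixSpace_mul_of_len_eq (a := b * a⁻¹) (b := a) (by rw [inv_mul_cancel_right, h])
  rw [inv_mul_cancel_right] at hab
  exact hab ▸ inf_le_right

theorem Le.sameCycle (h : a ≼ b) (hpq : a.SameCycle p q) : b.SameCycle p q := by
  rw [sameCycle_iff_forall_mem_fixSpace] at *
  exact fun f hf => hpq f (h.fixSpace_le hf)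

variable [DecidableEq α]

theorem len_swap (h : p ≠ q) : len (swap p q) = 1 := by
  let g : (α → ℚ) →ₗ[ℚ] ℚ :=
    LinearMap.proj (R := ℚ) (φ := fun _ => ℚ) p - LinearMap.proj (R := ℚ) (φ := fun _ => ℚ) q
  have ker_le : LinearMap.ker g ≤ fixSpace (swap p q) := fun f hf =>
    apply_swap_eq (sub_eq_zero.1 hf)
  have := Submodule.finrank_mono ker_le
  have hrange := Submodule.finrank_le (LinearMap.range g)
  have hker := LinearMap.finrank_range_add_finrank_ker g
  rw [finrank_self] at hrange
  rw [finrank_fintype_fun_eq_card] at hker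
  have := len_add_finrank_fixSpace (swap p q)
  have := (len_eq_zero_iff (swap p q)).not.2 (swap_eq_one_iff.not.2 h)
  omega

theorem sign_eq_neg_one_pow_len (w : Perm α) : Perm.sign w = (-1) ^ len w := by
  induction h : len w using Nat.strong_induction_on generalizing w with
  | _ k ih =>
    by_cases hw : w = 1
    · rw [← h, hw, len_one, map_one, pow_zero]
    obtain ⟨p, hp : w p ≠ p⟩ := DFunLike.ne_iff.1 hw
    have := Submodule.finrank_lt_finrank_of_lt (fixSpace_lt_swap_mul hp)
    have := len_add_finrank_fixSpace w
    have := len_add_finrank_fixSpace (swap p (w p) * w)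
    have hle := len_mul_le (swap p (w p)) (swap p (w p) * w)
    rw [swap_mul_self_mul, len_swap hp.symm] at hle
    have hsign := ih _ (by omega) (swap p (w p) * w) rfl
    rw [Perm.sign_mul, Perm.sign_swap hp.symm] at hsign
    rw [show k = len (swap p (w p) * w) + 1 by omega, pow_succ', ← hsign, neg_one_mul, neg_one_mul,
      neg_neg]

end FixSpace

section Interval

variable {α : Type*} [Fintype α] [DecidableEq α] {c v w x y : Perm α} {p q r s : α}

theorem len_mul_swap_ne (h : p ≠ q) (w : Perm α) : len (w * swap p q) ≠ len w := by
  intro hlen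
  have hsign := sign_eq_neg_one_pow_len (w * swap p q)
  rw [hlen, ← sign_eq_neg_one_pow_len, Perm.sign_mul, Perm.sign_swap h, mul_neg_one] at hsign
  exact units_ne_neg_self _ hsign.symm

theorem swap_le_of_sameCycle (h : w.SameCycle p q) : swap p q ≼ w := by
  rcases eq_or_ne p q with rfl | hpq
  · rw [swap_self]
    exact one_le w
  have hswap := len_swap hpq
  have hne : len (w * swap p q) ≠ len w + len (swap p q) := by
    intro hlen
    have hle : fixSpace w ≤ fixSpace (swap p q) := fun f hf =>
      apply_swap_eq (sameCycle_iff_forall_mem_fixSpace.1 h f hf)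
    have hfix := fixSpace_mul_of_len_eq hlen
    rw [inf_eq_left.2 hle] at hfix
    have := len_add_finrank_fixSpace w
    have := len_add_finrank_fixSpace (w * swap p q)
    rw [hfix] at this
    omega
  have := len_mul_swap_ne hpq w
  have := len_mul_le w (swap p q)
  have := len_mul_le (w * swap p q) (swap p q)
  rw [mul_swap_mul_self] at this
  rw [Le, swap_inv]
  omega

theorem swap_le_iff : swap p q ≼ w ↔ w.SameCycle p q :=
  ⟨fun h => h.sameCycle (sameCycle_swap p q), swap_le_of_sameCycle⟩

theorem exists_swap_le (hw : w ≠ 1) : ∃ p q, p ≠ q ∧ swap p q ≼ w := by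
  obtain ⟨p, hp : w p ≠ p⟩ := DFunLike.ne_iff.1 hw
  exact ⟨p, w p, hp.symm, swap_le_of_sameCycle ⟨1, by rw [zpow_one]⟩⟩

theorem len_mul_swap (hpq : p ≠ q) (h : swap p q ≼ w) : len (w * swap p q) + 1 = len w := by
  rw [← len_swap hpq, ← h, swap_inv]

theorem mul_swap_le (h : swap p q ≼ w) : w * swap p q ≼ w := by
  simpa only [swap_inv] using h.mul_inv_le

theorem le_mul_swap_iff (h : swap p q ≼ w) :
    x ≼ w * swap p q ↔ swap p q ≼ x * swap p q ∧ x * swap p q ≼ w := by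
  rw [← le_mul_inv_iff h, swap_inv]

theorem mul_swap_le_mul_swap (h : swap p q ≼ w) (hw : w ≼ c) :
    w * swap p q ≼ c * swap p q := by
  simpa only [swap_inv] using h.mul_inv_le_mul_inv hw

theorem not_sameCycle_mul_swap (hrs : r ≠ s) (h : swap r s ≼ w) :
    ¬(w * swap r s).SameCycle r s := by
  intro h'
  have := len_mul_swap hrs h
  have := len_mul_swap hrs (swap_le_iff.2 h')
  rw [mul_swap_mul_self] at this
  omega

theorem swap_mul_swap_le (ht : swap r s ≼ w) (h : (w * swap r s).SameCycle p q) :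
    swap r s ≼ swap p q * swap r s ∧ swap p q * swap r s ≼ w :=
  (le_mul_swap_iff ht).1 (swap_le_of_sameCycle h)

theorem sameCycle_mul_swap_of_le (hrs : r ≠ s) (ht : swap r s ≼ w) (hw : w ≼ c)
    (h : w.SameCycle p q) (hc : (c * swap r s).SameCycle p q) : (w * swap r s).SameCycle p q := by
  have hle := mul_swap_le_mul_swap ht hw
  have hrsc := not_sameCycle_mul_swap hrs (ht.trans hw)
  rcases sameCycle_mul_swap_cases r s h with hpq | ⟨hpr, hqs⟩ | ⟨hps, hqr⟩
  · exact hpq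
  · exact absurd ((hle.sameCycle hpr).symm.trans (hc.trans (hle.sameCycle hqs))) hrsc
  · exact absurd ((hle.sameCycle hqr).symm.trans (hc.symm.trans (hle.sameCycle hps))) hrsc

theorem sameCycle_mul_swap_and_of_le (hrs : r ≠ s) (ht : swap r s ≼ w) (hw : w ≼ c)
    (h : w.SameCycle p q) (hpr : (c * swap r s).SameCycle p r)
    (hqs : (c * swap r s).SameCycle q s) :
    (w * swap r s).SameCycle p r ∧ (w * swap r s).SameCycle q s := by
  have hle := mul_swap_le_mul_swap ht hw
  have hrsc := not_sameCycle_mul_swap hrs (ht.trans hw)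
  rcases sameCycle_mul_swap_cases r s h with hpq | hcycles | ⟨hps, -⟩
  · exact absurd (hpr.symm.trans ((hle.sameCycle hpq).trans hqs)) hrsc
  · exact hcycles
  · exact absurd (hpr.symm.trans (hle.sameCycle hps)) hrsc

theorem swap_mul_swap_mul_swap_le (ht : swap r s ≼ w) (hrs : r ≠ s)
    (hpr : (w * swap r s).SameCycle p r) (hqs : (w * swap r s).SameCycle q s) :
    swap p q ≼ swap p r * (swap q s * swap r s) ∧
    swap r s ≼ swap p r * (swap q s * swap r s) ∧
    swap p r * (swap q s * swap r s) ≼ w := by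
  have hpq : ¬(w * swap r s).SameCycle p q := fun h =>
    not_sameCycle_mul_swap hrs ht (hpr.symm.trans (h.trans hqs))
  obtain ⟨hright, hmul⟩ := swap_mul_swap_le ht hqs
  have hsep : swap p r ≼ w * (swap q s * swap r s)⁻¹ := by
    rw [mul_inv_rev, swap_inv, swap_inv, ← mul_assoc]
    exact swap_le_of_sameCycle (sameCycle_mul_swap_of_not_sameCycle hpr hqs hpq)
  obtain ⟨hright', hmul'⟩ := (le_mul_inv_iff hmul).1 hsep
  have hrs' := hright.trans hright'
  have hpr' := swap_le_iff.1 (left_le_mul_iff_right_le_mul.2 hright')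
  have hqs' := swap_le_iff.1 ((left_le_mul_iff_right_le_mul.2 hright).trans hright')
  exact ⟨swap_le_of_sameCycle (hpr'.trans ((swap_le_iff.1 hrs').trans hqs'.symm)), hrs', hmul'⟩

theorem exists_join_swap_of_sameCycle (hrs : r ≠ s) (hw : w ≼ c) (hw' : v ≼ c)
    (hp : swap p q ≼ w) (hp' : swap p q ≼ v) (hr : swap r s ≼ w) (hr' : swap r s ≼ v)
    (hpr : (c * swap r s).SameCycle p r) (hqs : (c * swap r s).SameCycle q s) :
    ∃ d, d ≼ w ∧ d ≼ v ∧ swap p q ≼ d ∧ swap r s ≼ d := by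
  obtain ⟨h₁, h₂⟩ := sameCycle_mul_swap_and_of_le hrs hr hw (swap_le_iff.1 hp) hpr hqs
  obtain ⟨h₁', h₂'⟩ := sameCycle_mul_swap_and_of_le hrs hr' hw' (swap_le_iff.1 hp') hpr hqs
  obtain ⟨hpd, hrd, hdw⟩ := swap_mul_swap_mul_swap_le hr hrs h₁ h₂
  exact ⟨_, hdw, (swap_mul_swap_mul_swap_le hr' hrs h₁' h₂').2.2, hpd, hrd⟩

theorem exists_join_swap (hrs : r ≠ s) (hw : w ≼ c) (hw' : v ≼ c) (hp : swap p q ≼ w)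
    (hp' : swap p q ≼ v) (hr : swap r s ≼ w) (hr' : swap r s ≼ v) :
    ∃ d, d ≼ w ∧ d ≼ v ∧ swap p q ≼ d ∧ swap r s ≼ d := by
  rcases sameCycle_mul_swap_cases r s (swap_le_iff.1 (hp.trans hw)) with
    hpq | ⟨hpr, hqs⟩ | ⟨hps, hqr⟩
  · obtain ⟨hrd, hdw⟩ := swap_mul_swap_le hr
      (sameCycle_mul_swap_of_le hrs hr hw (swap_le_iff.1 hp) hpq)
    obtain ⟨-, hdv⟩ := swap_mul_swap_le hr'
      (sameCycle_mul_swap_of_le hrs hr' hw' (swap_le_iff.1 hp') hpq)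
    exact ⟨_, hdw, hdv, left_le_mul_iff_right_le_mul.2 hrd, hrd⟩
  · exact exists_join_swap_of_sameCycle hrs hw hw' hp hp' hr hr' hpr hqs
  · rw [swap_comm r s] at *
    exact exists_join_swap_of_sameCycle hrs.symm hw hw' hp hp' hr hr' hps hqr

theorem exists_between_of_swap_le (k : ℕ)
    (ih : ∀ {w v x y : Perm α}, w ≼ c → v ≼ c → x ≼ w → x ≼ v → y ≼ w → y ≼ v → len w = k →
      ∃ z, x ≼ z ∧ y ≼ z ∧ z ≼ w ∧ z ≼ v)
    (hlen : len w = k + 1) (hw : w ≼ c) (hv : v ≼ c) (hpq : p ≠ q) (hpx : swap p q ≼ x)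
    (hpy : swap p q ≼ y) (hxw : x ≼ w) (hxv : x ≼ v) (hyw : y ≼ w) (hyv : y ≼ v) :
    ∃ z, x ≼ z ∧ y ≼ z ∧ z ≼ w ∧ z ≼ v := by
  have hpw := hpx.trans hxw
  have hpv := hpx.trans hxv
  obtain ⟨z, hxz, hyz, hzw, hzv⟩ := ih ((mul_swap_le hpw).trans hw) ((mul_swap_le hpv).trans hv)
    (mul_swap_le_mul_swap hpx hxw) (mul_swap_le_mul_swap hpx hxv) (mul_swap_le_mul_swap hpy hyw)
    (mul_swap_le_mul_swap hpy hyv) (by have := len_mul_swap hpq hpw; omega)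
  obtain ⟨hright, hzw⟩ := (le_mul_swap_iff hpw).1 hzw
  obtain ⟨-, hzv⟩ := (le_mul_swap_iff hpv).1 hzv
  have of_le {u : Perm α} (h : u * swap p q ≼ z) : u ≼ z * swap p q := by
    refine Le.of_mul_inv_le (s := swap p q) ?_ hright
    rwa [swap_inv, mul_swap_mul_self]
  exact ⟨z * swap p q, of_le hxz, of_le hyz, hzw, hzv⟩

omit [DecidableEq α] in
theorem exists_between (hw : w ≼ c) (hv : v ≼ c) (hxw : x ≼ w) (hxv : x ≼ v) (hyw : y ≼ w)
    (hyv : y ≼ v) : ∃ z, x ≼ z ∧ y ≼ z ∧ z ≼ w ∧ z ≼ v := by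
  classical
  induction hlen : len w generalizing w v x y with
  | zero =>
    rw [len_eq_zero_iff] at hlen
    subst hlen
    exact ⟨y, hxw.eq_one ▸ one_le y, Le.refl y, hyw, hyv⟩
  | succ k ih =>
    rcases eq_or_ne x 1 with rfl | hx
    · exact ⟨y, one_le y, Le.refl y, hyw, hyv⟩
    rcases eq_or_ne y 1 with rfl | hy
    · exact ⟨x, Le.refl x, one_le x, hxw, hxv⟩
    obtain ⟨p, q, hpq, hpx⟩ := exists_swap_le hx
    obtain ⟨r, s, hrs, hry⟩ := exists_swap_le hy
    obtain ⟨d, hdw, hdv, hpd, hrd⟩ := exists_join_swap hrs hw hv (hpx.trans hxw) (hpx.trans hxv)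
      (hry.trans hyw) (hry.trans hyv)
    obtain ⟨z, hxz, hdz, hzw, hzv⟩ :=
      exists_between_of_swap_le k ih hlen hw hv hpq hpx hpd hxw hxv hdw hdv
    obtain ⟨z', hyz', hzz', hzw', hzv'⟩ :=
      exists_between_of_swap_le k ih hlen hw hv hrs hry (hrd.trans hdz) hyw hyv hzw hzv
    exact ⟨z', hxz.trans hzz', hyz', hzw', hzv'⟩

omit [DecidableEq α] in
instance hasMeets_perm (c : Perm α) : HasMeets c where
  exists_meet {a b} ha hb := by
    obtain ⟨m, ⟨hma, hmb⟩, hmax⟩ := Set.exists_max_image {m | m ≼ a ∧ m ≼ b} len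
      (Set.toFinite _) ⟨1, one_le a, one_le b⟩
    refine ⟨m, fun x => ⟨fun hx => ⟨hx.trans hma, hx.trans hmb⟩, fun ⟨hxa, hxb⟩ => ?_⟩⟩
    obtain ⟨z, hmz, hxz, hza, hzb⟩ := exists_between ha hb hma hmb hxa hxb
    exact hmz.eq_of_len_le (hmax z ⟨hza, hzb⟩) ▸ hxz

end Interval

section Lift

variable {α : Type*} [Fintype α] [DecidableEq α] {c w y z : Perm α} {p q r s : α}

section Monoid

variable {G : Type*} [Monoid G] {A : α → α → G} {b b' : G}

/-- `IsLift A w b`: the element `b` is the product of the `A p q` along a decomposition of the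
permutation `w` into the smallest possible number of transpositions `(p q)`. -/
inductive IsLift (A : α → α → G) : Perm α → G → Prop
  | one : IsLift A 1 1
  | mul_swap {w : Perm α} {b : G} (p q : α) (hpq : p ≠ q) (h : IsLift A w b)
      (hl : swap p q ≼ w * swap p q) : IsLift A (w * swap p q) (b * A p q)

theorem IsLift.of_mul_swap (hpq : p ≠ q) (hle : swap p q ≼ w) (h : IsLift A (w * swap p q) b) :
    IsLift A w (b * A p q) := by
  simpa only [mul_swap_mul_self, hle, forall_const] using IsLift.mul_swap p q hpq h

theorem exists_isLift (A : α → α → G) (w : Perm α) : ∃ b, IsLift A w b := by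
  induction hlen : len w using Nat.strong_induction_on generalizing w with
  | _ k ih =>
    rcases eq_or_ne w 1 with rfl | hw
    · exact ⟨1, .one⟩
    obtain ⟨p, q, hpq, hle⟩ := exists_swap_le hw
    obtain ⟨b, hb⟩ := ih _ (by have := len_mul_swap hpq hle; omega) (w * swap p q) rfl
    exact ⟨_, hb.of_mul_swap hpq hle⟩

theorem IsLift.mul (hz : IsLift A z b') (hy : IsLift A y b) (h : z ≼ y * z) :
    IsLift A (y * z) (b * b') := by
  induction hz with
  | one => simpa only [mul_one] using hy
  | @mul_swap w b' p q hpq _ hle ih =>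
    obtain ⟨hw, hle'⟩ := mul_le_mul_assoc.1 ⟨hle, h⟩
    rw [← mul_assoc, ← mul_assoc]
    exact .mul_swap p q hpq (ih hw) hle'

theorem isLift_swap (h : p ≠ q) : IsLift A (swap p q) (A p q) := by
  simpa only [one_mul, Le.refl, forall_const] using IsLift.mul_swap p q h (.one (A := A))

theorem IsLift.mem {K : Submonoid G} (h : IsLift A w b)
    (hK : ∀ p q, p ≠ q → swap p q ≼ w → A p q ∈ K) : b ∈ K := by
  induction h with
  | one => exact K.one_mem
  | mul_swap p q hpq _ hle ih =>
    refine K.mul_mem (ih fun r s hrs hr => hK r s hrs ?_) (hK p q hpq hle)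
    exact hr.trans (left_le_mul_iff_right_le_mul.2 hle)

theorem IsLift.eq_one_or (h : IsLift A w b) : (w = 1 ∧ b = 1) ∨
    ∃ p q x, p ≠ q ∧ swap p q ≼ w ∧ IsLift A (w * swap p q) x ∧ b = x * A p q := by
  cases h with
  | one => exact Or.inl ⟨rfl, rfl⟩
  | @mul_swap w x p q hpq h hle =>
    exact Or.inr ⟨p, q, x, hpq, hle, by rwa [mul_swap_mul_self], rfl⟩

/-- The Hurwitz relations: the `A p q` satisfy all the relations `t u = (t u t⁻¹) t` between
transpositions `t` and `u` for which `t * u` has length two and lies below `c`. -/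
structure HurwitzRel (c : Perm α) (A : α → α → G) : Prop where
  comm (p q : α) : A p q = A q p
  rel {p q r s : α} : p ≠ q → r ≠ s → swap r s ≼ swap p q * swap r s → swap p q * swap r s ≼ c →
    A p q * A r s = A (swap p q r) (swap p q s) * A p q

theorem HurwitzRel.mono (hA : HurwitzRel c A) (hw : w ≼ c) : HurwitzRel w A :=
  ⟨hA.comm, fun hpq hrs hle hle' => hA.rel hpq hrs hle (hle'.trans hw)⟩

/-- All the lifts of `w` that end with `A p q` are equal to all those that end with `A r s`. -/
def Exchangeable (A : α → α → G) (w : Perm α) (p q r s : α) : Prop :=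
  ∀ ⦃x y⦄, IsLift A (w * swap p q) x → IsLift A (w * swap r s) y → x * A p q = y * A r s

theorem Exchangeable.symm (h : Exchangeable A w p q r s) : Exchangeable A w r s p q :=
  fun _ _ hx hy => (h hy hx).symm

theorem Exchangeable.trans {t u : α} (h : Exchangeable A w p q r s)
    (h' : Exchangeable A w r s t u) : Exchangeable A w p q t u := by
  intro x y hx hy
  obtain ⟨z, hz⟩ := exists_isLift A (w * swap r s)
  exact (h hx hz).trans (h' hz hy)

theorem HurwitzRel.exchangeable_symm (hA : HurwitzRel w A) (h : Exchangeable A w p q r s) :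
    Exchangeable A w p q s r := by
  intro x y hx hy
  rw [swap_comm s r] at hy
  rw [hA.comm s r]
  exact h hx hy

section Uniqueness

variable (hA : HurwitzRel w A) (hw : ∀ v, v ≼ w → v ≠ w → {b | IsLift A v b}.Subsingleton)

include hw

theorem subsingleton_isLift_mul_swap (hpq : p ≠ q) (hle : swap p q ≼ w) :
    {b | IsLift A (w * swap p q) b}.Subsingleton :=
  hw _ (mul_swap_le hle) (mul_eq_left.not.2 (swap_eq_one_iff.not.2 hpq))

include hA

theorem exchangeable_of_sameCycle_mul_swap (hpq : p ≠ q) (hrs : r ≠ s) (hle : swap r s ≼ w)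
    (h : (w * swap r s).SameCycle p q) : Exchangeable A w p q r s := by
  intro x y hx hy
  obtain ⟨hright, hmul⟩ := swap_mul_swap_le hle h
  have hleft : swap p q ≼ swap p q * swap r s := left_le_mul_iff_right_le_mul.2 hright
  have hpqw : swap p q ≼ w := hleft.trans hmul
  obtain ⟨z, hz⟩ := exists_isLift A (w * swap r s * swap p q)
  have hy' : y = z * A p q := subsingleton_isLift_mul_swap hw hrs hle hy
    (hz.of_mul_swap hpq (swap_le_of_sameCycle h))
  have hconj : swap (swap p q r) (swap p q s) = swap p q * swap r s * swap p q := by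
    rw [swap_apply_apply, swap_inv]
  have hx' : x = z * A (swap p q r) (swap p q s) := by
    refine subsingleton_isLift_mul_swap hw hpq hpqw hx
      (IsLift.of_mul_swap ((swap p q).injective.ne hrs) ?_ ?_)
    · rw [hconj, le_mul_swap_iff hpqw, mul_swap_mul_self]
      exact ⟨hleft, hmul⟩
    · rwa [hconj, mul_assoc w, mul_assoc (swap p q), swap_mul_self_mul, ← mul_assoc]
  rw [hx', hy', mul_assoc, mul_assoc, hA.rel hpq hrs hright hmul]

theorem exchangeable_of_eq_left (hpq : p ≠ q) (hps : p ≠ s) (hq : swap p q ≼ w)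
    (hs : swap p s ≼ w) : Exchangeable A w p q p s := by
  rcases eq_or_ne q s with rfl | hqs
  · intro x y hx hy
    rw [subsingleton_isLift_mul_swap hw hpq hq hx hy]
  by_cases h : (w * swap p s).SameCycle p q
  · exact exchangeable_of_sameCycle_mul_swap hA hw hpq hps hs h
  refine (exchangeable_of_sameCycle_mul_swap hA hw hps hpq hq ?_).symm
  have hqs' : (w * swap p s).SameCycle q s := by
    rcases sameCycle_mul_swap_cases p s (swap_le_iff.1 hq) with hpq' | ⟨-, hqs'⟩ | ⟨hps', -⟩
    · exact absurd hpq' h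
    · exact hqs'
    · exact absurd hps' (not_sameCycle_mul_swap hps hs)
  obtain ⟨hright, hmul⟩ := swap_mul_swap_le hs hqs'
  have hpq' : swap p q ≼ swap q s * swap p s := swap_le_of_sameCycle ((swap_le_iff.1 hright).trans
    (swap_le_iff.1 (left_le_mul_iff_right_le_mul.2 hright)).symm)
  have hprod : swap q s * swap p s = swap p s * swap p q := by
    rw [swap_mul_eq_mul_swap, swap_inv, swap_apply_right, swap_apply_of_ne_of_ne hpq.symm hqs,
      swap_comm q p]
  rw [hprod] at hpq' hmul
  exact swap_le_iff.1 ((le_mul_swap_iff hq).2 ⟨hpq', hmul⟩)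

theorem exchangeable_of_sameCycle (hpq : p ≠ q) (hrs : r ≠ s) (hp : swap p q ≼ w)
    (hr : swap r s ≼ w) (h : w.SameCycle p r) : Exchangeable A w p q r s := by
  rcases eq_or_ne p r with rfl | hpr
  · exact exchangeable_of_eq_left hA hw hpq hrs hp hr
  have hpr' := swap_le_of_sameCycle h
  have hstart := exchangeable_of_eq_left hA hw hpq hpr hp hpr'
  refine (hA.exchangeable_symm hstart).trans ?_
  rw [swap_comm] at hpr'
  exact exchangeable_of_eq_left hA hw hpr.symm hrs hpr' hr

theorem exchangeable (hpq : p ≠ q) (hrs : r ≠ s) (hp : swap p q ≼ w) (hr : swap r s ≼ w) :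
    Exchangeable A w p q r s := by
  by_cases h : w.SameCycle p r
  · exact exchangeable_of_sameCycle hA hw hpq hrs hp hr h
  have hrs' := swap_le_iff.1 hr
  refine exchangeable_of_sameCycle_mul_swap hA hw hpq hrs hr ?_
  rcases sameCycle_mul_swap_cases r s (swap_le_iff.1 hp) with hpq' | ⟨hpr, -⟩ | ⟨hps, -⟩
  · exact hpq'
  · exact absurd (sameCycle_of_sameCycle_mul_swap hrs' hpr) h
  · exact absurd ((sameCycle_of_sameCycle_mul_swap hrs' hps).trans hrs'.symm) h

end Uniqueness

theorem IsLift.unique (hA : HurwitzRel w A) (h : IsLift A w b) (h' : IsLift A w b') : b = b' := by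
  induction hlen : len w using Nat.strong_induction_on generalizing w b b' with
  | _ k ih =>
    have hw (v : Perm α) (hvw : v ≼ w) (hne : v ≠ w) : {b | IsLift A v b}.Subsingleton := by
      intro x hx y hy
      refine ih _ ?_ (hA.mono hvw) hx hy rfl
      by_contra hlt
      exact hne (hvw.eq_of_len_le (by omega))
    rcases h.eq_one_or with ⟨hw1, hb⟩ | ⟨p, q, x, hpq, hp, hx, rfl⟩ <;>
      rcases h'.eq_one_or with ⟨hw1', hb'⟩ | ⟨r, s, y, hrs, hr, hy, rfl⟩
    · rw [hb, hb']
    · exact absurd (hw1 ▸ hr).eq_one (mt swap_eq_one_iff.1 hrs)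
    · exact absurd (hw1' ▸ hp).eq_one (mt swap_eq_one_iff.1 hpq)
    · exact exchangeable hA hw hpq hrs hp hr hx hy

/-- The product of the `A p q` along some decomposition of a permutation into the smallest possible
number of transpositions `(p q)`. -/
noncomputable def lift (A : α → α → G) (w : Perm α) : G := (exists_isLift A w).choose

theorem isLift_lift (A : α → α → G) (w : Perm α) : IsLift A w (lift A w) :=
  (exists_isLift A w).choose_spec

theorem isIntervalHom_lift (hA : HurwitzRel c A) : IsIntervalHom c (lift A) := fun _ z hz hc =>
  (isLift_lift A _).unique (hA.mono hc) ((isLift_lift A z).mul (isLift_lift A _) hz)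

theorem lift_swap (hA : HurwitzRel c A) (h : p ≠ q) (hle : swap p q ≼ c) :
    lift A (swap p q) = A p q :=
  (isLift_lift A _).unique (hA.mono hle) (isLift_swap h)

end Monoid

theorem IsIntervalHom.hurwitzRel {G : Type*} [Group G] {F : Perm α → G} (hF : IsIntervalHom c F) :
    HurwitzRel c fun p q => F (swap p q) where
  comm p q := by rw [swap_comm]
  rel {p q r s} _ _ hle hc := by
    have hconj : swap (swap p q r) (swap p q s) * swap p q = swap p q * swap r s := by
      rw [swap_apply_apply, swap_inv, mul_swap_mul_self]
    have hle' : swap p q ≼ swap (swap p q r) (swap p q s) * swap p q :=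
      hconj ▸ left_le_mul_iff_right_le_mul.2 hle
    rw [← hF hle hc, ← hF hle' (hconj ▸ hc), hconj]

theorem IsLift.map_eq {G H : Type*} [Monoid G] [Group H] {A : α → α → G} {F : Perm α → H} {b : G}
    (hF : IsIntervalHom c F) (f : G →* H)
    (hf : ∀ p q, p ≠ q → swap p q ≼ c → f (A p q) = F (swap p q)) (h : IsLift A w b)
    (hw : w ≼ c) : f b = F w := by
  induction h with
  | one => rw [map_one, hF.map_one]
  | mul_swap p q hpq _ hle ih =>
    rw [map_mul, hF hle hw, ih ((left_le_mul_iff_right_le_mul.2 hle).trans hw),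
      hf p q hpq (hle.trans hw)]

end Lift

end AbsoluteLength

namespace ArtinBraid

variable {n : ℕ}

theorem commute_sigma {i j : ℕ} (h : i + 2 ≤ j) : Commute (sigma n i) (sigma n j) := by
  by_cases hi : 1 ≤ i
  · by_cases hj : j < n
    · exact sigma_comm n hi h hj
    · rw [show sigma n j = 1 from dif_neg (by omega)]
      exact Commute.one_right _
  · rw [show sigma n i = 1 from dif_neg (by omega)]
    exact Commute.one_left _

theorem delta_self (p : ℕ) : delta n p p = 1 := by simp [delta]

theorem delta_mul {p q r : ℕ} (h1 : p ≤ q) (h2 : q ≤ r) :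
    delta n p q * delta n q r = delta n p r := by
  have happend := List.range'_append_1 (s := p) (m := q - p) (n := r - q)
  rw [show p + (q - p) = q by omega, show q - p + (r - q) = r - p by omega] at happend
  rw [delta, delta, delta, ← happend, List.map_append, List.prod_append]

theorem delta_succ_self (p : ℕ) : delta n p (p + 1) = sigma n p := by simp [delta]

theorem delta_succ {p q : ℕ} (h : p ≤ q) : delta n p (q + 1) = delta n p q * sigma n q := by
  rw [← delta_mul h (Nat.le_succ q), delta_succ_self]

theorem delta_eq_sigma_mul {p q : ℕ} (h : p < q) :
    delta n p q = sigma n p * delta n (p + 1) q := by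
  rw [← delta_mul (Nat.le_succ p) h, delta_succ_self]

theorem a_succ (p q : ℕ) : a n p (q + 1) = delta n p q * sigma n q * (delta n p q)⁻¹ := by
  simp [a]

theorem a_succ_self (p : ℕ) : a n p (p + 1) = sigma n p := by
  simp [a_succ, delta_self]

theorem a_mul_delta {p q : ℕ} (h : p ≤ q) : a n p (q + 1) * delta n p q = delta n p (q + 1) := by
  rw [a_succ, delta_succ h, inv_mul_cancel_right]

theorem commute_delta {p q : ℕ} {x : ArtinBraid n}
    (h : ∀ i, p ≤ i → i < q → Commute (sigma n i) x) : Commute (delta n p q) x := by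
  by_cases hpq : p ≤ q
  · induction q, hpq using Nat.le_induction with
    | base =>
      rw [delta_self]
      exact Commute.one_left x
    | succ q hq ih =>
      rw [delta_succ hq]
      exact (ih fun i h1 h2 => h i h1 (by omega)).mul_left (h q hq (by omega))
  · rw [delta, show q - p = 0 by omega]
    exact Commute.one_left x

theorem commute_a {p q : ℕ} (hpq : p < q) {x : ArtinBraid n}
    (h : ∀ i, p ≤ i → i < q → Commute (sigma n i) x) : Commute (a n p q) x := by
  obtain ⟨q, rfl⟩ : ∃ k, q = k + 1 := ⟨q - 1, by omega⟩
  rw [a_succ]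
  have hdelta := commute_delta (q := q) fun i h1 h2 => h i h1 (by omega)
  exact (hdelta.mul_left (h q (by omega) (by omega))).mul_left hdelta.inv_left

theorem commute_sigma_a {i p q : ℕ} (hpq : p < q) (h : i + 2 ≤ p ∨ q + 1 ≤ i) :
    Commute (sigma n i) (a n p q) := by
  refine (commute_a hpq fun j h1 h2 => ?_).symm
  rcases h with h | h
  · exact (commute_sigma (by omega)).symm
  · exact commute_sigma (by omega)

theorem a_eq_conj {p q r : ℕ} (h1 : p ≤ q) (h2 : q < r) :
    a n p r = delta n p q * a n q r * (delta n p q)⁻¹ := by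
  obtain ⟨r, rfl⟩ : ∃ k, r = k + 1 := ⟨r - 1, by omega⟩
  rw [a_succ, a_succ, ← delta_mul h1 (by omega : q ≤ r)]
  group

theorem a_eq_sigma_conj {p r : ℕ} (h : p + 1 < r) :
    a n p r = sigma n p * a n (p + 1) r * (sigma n p)⁻¹ := by
  rw [a_eq_conj (Nat.le_succ p) h, delta_succ_self]

theorem a_mul_a_left {p q r : ℕ} (h1 : p < q) (h2 : q < r) :
    a n p q * a n q r = a n p r * a n p q := by
  obtain ⟨q, rfl⟩ : ∃ k, q = k + 1 := ⟨q - 1, by omega⟩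
  have hcomm : Commute (delta n p q) (a n (q + 1) r) :=
    commute_delta fun i _ h => commute_sigma_a h2 (Or.inl (by omega))
  rw [a_eq_conj h1.le h2, ← a_mul_delta (by omega : p ≤ q), mul_inv_rev]
  calc a n p (q + 1) * a n (q + 1) r
      = a n p (q + 1) * (a n (q + 1) r * delta n p q) * (delta n p q)⁻¹ := by group
    _ = _ := by rw [← hcomm.eq]; group

theorem sigma_mul_a {q r : ℕ} (hq : 1 ≤ q) (hqr : q < r) (hr : r < n) :
    sigma n r * a n q (r + 1) = a n q r * sigma n r := by
  obtain ⟨r, rfl⟩ : ∃ k, r = k + 1 := ⟨r - 1, by omega⟩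
  have hcomm : Commute (delta n q r) (sigma n (r + 1)) :=
    commute_delta fun i _ h => commute_sigma (by omega)
  rw [a_succ, a_succ, delta_succ (by omega : q ≤ r), mul_inv_rev]
  calc sigma n (r + 1) * (delta n q r * sigma n r * sigma n (r + 1) *
        ((sigma n r)⁻¹ * (delta n q r)⁻¹))
      = (sigma n (r + 1) * delta n q r) * sigma n r * sigma n (r + 1) *
        ((sigma n r)⁻¹ * (delta n q r)⁻¹) := by group
    _ = delta n q r * (sigma n (r + 1) * sigma n r * sigma n (r + 1)) *
        ((sigma n r)⁻¹ * (delta n q r)⁻¹) := by rw [← hcomm.eq]; group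
    _ = delta n q r * sigma n r * (sigma n (r + 1) * (delta n q r)⁻¹) := by
        rw [← sigma_braid n (i := r) (by omega) hr]; group
    _ = _ := by rw [← hcomm.inv_left.eq]; group

theorem a_succ_right {q r : ℕ} (hq : 1 ≤ q) (hqr : q < r) (hr : r < n) :
    a n q (r + 1) = (sigma n r)⁻¹ * a n q r * sigma n r := by
  rw [mul_assoc, ← sigma_mul_a hq hqr hr, inv_mul_cancel_left]

theorem sigma_a_braid {p r : ℕ} (hp : 1 ≤ p) (hpr : p + 2 ≤ r) (hr : r ≤ n) :
    sigma n p * a n (p + 1) r * sigma n p = a n (p + 1) r * sigma n p * a n (p + 1) r := by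
  induction r, hpr using Nat.le_induction with
  | base =>
    rw [a_succ_self]
    exact sigma_braid n hp (by omega)
  | succ r hpr ih =>
    have hcomm : Commute (sigma n p) (sigma n r) := commute_sigma (by omega)
    rw [a_succ_right (by omega) (by omega) (by omega)]
    calc sigma n p * ((sigma n r)⁻¹ * a n (p + 1) r * sigma n r) * sigma n p
        = (sigma n p * (sigma n r)⁻¹) * a n (p + 1) r * (sigma n r * sigma n p) := by group
      _ = (sigma n r)⁻¹ * (sigma n p * a n (p + 1) r * sigma n p) * sigma n r := by
          rw [hcomm.inv_right.eq, ← hcomm.eq]; group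
      _ = (sigma n r)⁻¹ * a n (p + 1) r * (sigma n p * sigma n r) * (sigma n r)⁻¹ *
          a n (p + 1) r * sigma n r := by rw [ih (by omega)]; group
      _ = _ := by rw [hcomm.eq]; group

theorem a_mul_a_right {p q r : ℕ} (hp : 1 ≤ p) (h1 : p < q) (h2 : q < r) (hr : r ≤ n) :
    a n q r * a n p r = a n p q * a n q r := by
  obtain ⟨q, rfl⟩ : ∃ k, q = k + 1 := ⟨q - 1, by omega⟩
  have hcomm : Commute (delta n p q) (a n (q + 1) r) :=
    commute_delta fun i _ h => commute_sigma_a h2 (Or.inl (by omega))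
  rw [a_succ, a_eq_conj (by omega : p ≤ q) (by omega : q < r), a_eq_sigma_conj h2]
  calc a n (q + 1) r * (delta n p q * (sigma n q * a n (q + 1) r * (sigma n q)⁻¹) *
        (delta n p q)⁻¹)
      = (a n (q + 1) r * delta n p q) * (sigma n q * a n (q + 1) r * (sigma n q)⁻¹) *
        (delta n p q)⁻¹ := by group
    _ = delta n p q * (a n (q + 1) r * sigma n q * a n (q + 1) r) * (sigma n q)⁻¹ *
        (delta n p q)⁻¹ := by rw [← hcomm.eq]; group
    _ = delta n p q * sigma n q * (a n (q + 1) r * (delta n p q)⁻¹) := by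
        rw [← sigma_a_braid (by omega) h2 hr]; group
    _ = _ := by rw [← hcomm.inv_left.eq]; group

theorem commute_a_of_lt {p q r s : ℕ} (h1 : p < q) (h2 : q < r) (h3 : r < s) :
    Commute (a n p q) (a n r s) :=
  commute_a h1 fun _ _ _ => commute_sigma_a h3 (Or.inl (by omega))

theorem mul_mul_inv_eq_of_braid {G : Type*} [Group G] {x y : G} (h : x * y * x = y * x * y) :
    x * y * x⁻¹ = y⁻¹ * x * y := by
  rw [mul_inv_eq_iff_eq_mul, mul_assoc, mul_assoc, eq_inv_mul_iff_mul_eq, ← mul_assoc, ← mul_assoc,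
    h]

theorem commute_conj_of_braid {G : Type*} [Group G] {x y z : G} (hxy : x * y * x = y * x * y)
    (hyz : y * z * y = z * y * z) (hxz : Commute x z) : Commute (z⁻¹ * (x * y * x⁻¹) * z) y := by
  rw [mul_mul_inv_eq_of_braid hxy]
  refine (mul_inv_eq_iff_eq_mul.1 ?_).symm
  calc y * (z⁻¹ * (y⁻¹ * x * y) * z) * y⁻¹
      = (y * z * y⁻¹)⁻¹ * x * (y * z * y⁻¹) := by group
    _ = z⁻¹ * y⁻¹ * (z * x) * z⁻¹ * y * z := by rw [mul_mul_inv_eq_of_braid hyz]; group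
    _ = _ := by rw [← hxz.eq]; group

theorem a_sigma_braid {r s : ℕ} (hr : 1 ≤ r) (h : r < s) (hs : s < n) :
    a n r s * sigma n s * a n r s = sigma n s * a n r s * sigma n s := by
  obtain ⟨s, rfl⟩ : ∃ k, s = k + 1 := ⟨s - 1, by omega⟩
  have hcomm : Commute (delta n r s) (sigma n (s + 1)) :=
    commute_delta fun i _ h => commute_sigma (by omega)
  have hsigma : sigma n (s + 1) = delta n r s * sigma n (s + 1) * (delta n r s)⁻¹ := by
    rw [hcomm.eq, mul_inv_cancel_right]
  rw [a_succ, hsigma]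
  calc _ = delta n r s * (sigma n s * sigma n (s + 1) * sigma n s) * (delta n r s)⁻¹ := by group
    _ = _ := by rw [sigma_braid n (by omega) hs]; group

theorem commute_a_a_succ {q r s : ℕ} (hr : 1 ≤ r) (hrs : r + 1 < s) (hsq : s < q) (hq : q ≤ n) :
    Commute (a n r q) (a n (r + 1) s) := by
  induction q, (show s + 1 ≤ q from hsq) using Nat.le_induction with
  | base =>
    rw [a_succ_right hr (by omega) (by omega), a_eq_sigma_conj hrs]
    exact commute_conj_of_braid (sigma_a_braid hr hrs (by omega))
      (a_sigma_braid (by omega) hrs (by omega)) (commute_sigma (by omega))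
  | succ q hsq ih =>
    have hcomm : Commute (sigma n q) (a n (r + 1) s) := commute_sigma_a hrs (Or.inr (by omega))
    rw [a_succ_right hr (by omega) (by omega)]
    exact (hcomm.inv_left.mul_left (ih (by omega) (by omega))).mul_left hcomm

theorem commute_a_nested {p q r s : ℕ} (hp : 1 ≤ p) (h1 : p < r) (h2 : r < s) (h3 : s < q)
    (hq : q ≤ n) : Commute (a n p q) (a n r s) := by
  obtain ⟨r, rfl⟩ : ∃ k, r = k + 1 := ⟨r - 1, by omega⟩
  have hcomm : Commute (delta n p r) (a n (r + 1) s) :=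
    commute_delta fun i _ h => commute_sigma_a h2 (Or.inl (by omega))
  rw [a_eq_conj (by omega : p ≤ r) (by omega : r < q)]
  exact (hcomm.mul_left (commute_a_a_succ (by omega) h2 h3 hq)).mul_left hcomm.inv_left

theorem phi_apply (β : ArtinBraid n) : phi n β = delta n 1 n * β * (delta n 1 n)⁻¹ := rfl

theorem phi_sigma {i : ℕ} (hi : 1 ≤ i) (hin : i + 1 < n) :
    phi n (sigma n i) = sigma n (i + 1) := by
  have hright : Commute (delta n (i + 2) n) (sigma n i) :=
    commute_delta fun j h _ => (commute_sigma (by omega)).symm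
  have hleft : Commute (delta n 1 i) (sigma n (i + 1)) :=
    commute_delta fun j _ h => commute_sigma (by omega)
  have hsplit : delta n 1 n = delta n 1 i * sigma n i * sigma n (i + 1) * delta n (i + 2) n := by
    rw [← delta_mul hi (by omega : i ≤ n), delta_eq_sigma_mul (by omega : i < n),
      delta_eq_sigma_mul hin]
    simp only [mul_assoc]
  rw [phi_apply, mul_inv_eq_iff_eq_mul, hsplit]
  calc delta n 1 i * sigma n i * sigma n (i + 1) * delta n (i + 2) n * sigma n i
      = delta n 1 i * sigma n i * sigma n (i + 1) * (delta n (i + 2) n * sigma n i) := by group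
    _ = delta n 1 i * (sigma n i * sigma n (i + 1) * sigma n i) * delta n (i + 2) n := by
        rw [hright.eq]; group
    _ = (delta n 1 i * sigma n (i + 1)) * sigma n i * sigma n (i + 1) * delta n (i + 2) n := by
        rw [sigma_braid n hi hin]; group
    _ = _ := by rw [hleft.eq]; group

theorem phi_delta {p q : ℕ} (hp : 1 ≤ p) (hpq : p ≤ q) (hq : q < n) :
    phi n (delta n p q) = delta n (p + 1) (q + 1) := by
  induction q, hpq using Nat.le_induction with
  | base => rw [delta_self, delta_self, map_one]
  | succ q hpq ih =>
    rw [delta_succ hpq, map_mul, ih (by omega), phi_sigma (by omega) (by omega),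
      ← delta_succ (by omega)]

theorem phi_a {p q : ℕ} (hp : 1 ≤ p) (hpq : p < q) (hq : q < n) :
    phi n (a n p q) = a n (p + 1) (q + 1) := by
  obtain ⟨q, rfl⟩ : ∃ k, q = k + 1 := ⟨q - 1, by omega⟩
  rw [a_succ, a_succ, map_mul, map_mul, map_inv, phi_delta hp (by omega) (by omega),
    phi_sigma (by omega) hq]

theorem delta_eq_delta_mul_a {p q : ℕ} (hp : 1 ≤ p) (hpq : p < q) (hq : q ≤ n) :
    delta n p q = delta n (p + 1) q * a n p q := by
  induction q, (show p + 1 ≤ q from hpq) using Nat.le_induction with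
  | base => rw [delta_self, delta_succ_self, a_succ_self, one_mul]
  | succ q h ih =>
    rw [delta_succ (by omega), ih (by omega) (by omega), delta_succ h, mul_assoc, mul_assoc,
      sigma_mul_a hp (by omega) (by omega)]

theorem phi_a_last {p : ℕ} (hp : 1 ≤ p) (hpn : p < n) : phi n (a n p n) = a n 1 (p + 1) := by
  have hsplit := delta_eq_delta_mul_a hp hpn le_rfl
  have hconj : delta n p n * a n p n = sigma n p * delta n p n := by
    rw [delta_eq_sigma_mul hpn, mul_assoc, ← hsplit, ← delta_eq_sigma_mul hpn]
  rw [phi_apply, mul_inv_eq_iff_eq_mul, ← delta_mul hp hpn.le, mul_assoc, hconj, ← mul_assoc,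
    ← mul_assoc, a_mul_delta hp, delta_succ hp]

end ArtinBraid

namespace ArtinBraid

open Equiv AbsoluteLength

section FinRotate

variable {n : ℕ} {p q r s : Fin (n + 1)}

theorem sameCycle_finRotate (p q : Fin (n + 1)) : (finRotate (n + 1)).SameCycle p q := by
  cases n with
  | zero => rw [Subsingleton.elim (α := Fin 1) p q]
  | succ n =>
    have hsupport (i : Fin (n + 2)) : finRotate (n + 2) i ≠ i :=
      Perm.mem_support.1 (support_finRotate ▸ Finset.mem_univ i)
    exact isCycle_finRotate.sameCycle (hsupport p) (hsupport q)

theorem swap_le_finRotate (p q : Fin (n + 1)) : swap p q ≼ finRotate (n + 1) :=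
  swap_le_of_sameCycle (sameCycle_finRotate p q)

theorem finRotate_of_val_eq_succ (h : q.1 = p.1 + 1) : finRotate (n + 1) p = q := by
  rw [finRotate_apply]
  ext
  rw [Fin.val_add_one_of_lt (by rw [Fin.lt_def, Fin.val_last]; omega), h]

theorem sameCycle_finRotate_mul_swap (h : q.1 = p.1 + 1) (hr : p ≠ r) (hs : p ≠ s) :
    (finRotate (n + 1) * swap r s).SameCycle p q :=
  ⟨1, by rw [zpow_one, Perm.mul_apply, swap_apply_of_ne_of_ne hr hs, finRotate_of_val_eq_succ h]⟩

theorem finRotate_mul_swap_apply_mem_Ioc (hrs : r < s) (x : Fin (n + 1)) :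
    (finRotate (n + 1) * swap r s) x ∈ Set.Ioc r s ↔ x ∈ Set.Ioc r s := by
  have hs := s.2
  have hx := x.2
  rw [Fin.lt_def] at hrs
  simp only [Set.mem_Ioc, Perm.mul_apply, finRotate_apply, Fin.lt_def, Fin.le_def,
    Fin.val_add_one, Fin.ext_iff, Fin.val_last]
  rcases eq_or_ne x r with rfl | hxr
  · rw [swap_apply_left]
    split_ifs <;> omega
  rcases eq_or_ne x s with rfl | hxs
  · rw [swap_apply_right, if_neg (by omega)]
    omega
  rw [swap_apply_of_ne_of_ne hxr hxs]
  rw [Ne, Fin.ext_iff] at hxr hxs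
  split_ifs <;> omega

theorem mem_Ioc_iff_of_sameCycle (hrs : r < s)
    (h : (finRotate (n + 1) * swap r s).SameCycle p q) : p ∈ Set.Ioc r s ↔ q ∈ Set.Ioc r s :=
  iff_of_eq <| eq_of_sameCycle (f := (· ∈ Set.Ioc r s))
    (fun x => propext (finRotate_mul_swap_apply_mem_Ioc hrs x)) h

end FinRotate

section Atom

variable {n : ℕ} {p q r s : Fin (n + 1)}

/-- The Birman-Ko-Lee generators of `B_{n+1}`, indexed by the pairs of points of `Fin (n + 1)`, in
either order. The value on the diagonal is never used. -/
def atom (n : ℕ) (p q : Fin (n + 1)) : ArtinBraid (n + 1) :=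
  a (n + 1) (min p.1 q.1 + 1) (max p.1 q.1 + 1)

theorem atom_comm (p q : Fin (n + 1)) : atom n p q = atom n q p := by
  rw [atom, atom, min_comm, max_comm]

theorem atom_of_lt (h : p < q) : atom n p q = a (n + 1) (p.1 + 1) (q.1 + 1) := by
  rw [Fin.lt_def] at h
  rw [atom, min_eq_left h.le, max_eq_right h.le]

theorem commute_atom (hpq : p < q) (hrs : r < s) (hpr : p ≠ r) (hps : p ≠ s) (hqr : q ≠ r)
    (hqs : q ≠ s) (h : p ∈ Set.Ioc r s ↔ q ∈ Set.Ioc r s) :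
    Commute (atom n p q) (atom n r s) := by
  have hq := q.2
  have hs := s.2
  rw [atom_of_lt hpq, atom_of_lt hrs]
  rw [Ne, Fin.ext_iff] at hpr hps hqr hqs
  simp only [Set.mem_Ioc, Fin.lt_def, Fin.le_def] at *
  by_cases hleft : q.1 < r.1
  · exact commute_a_of_lt (by omega) (by omega) (by omega)
  by_cases hright : s.1 < p.1
  · exact (commute_a_of_lt (by omega) (by omega) (by omega)).symm
  by_cases houter : p.1 < r.1
  · exact commute_a_nested (by omega) (by omega) (by omega) (by omega) (by omega)
  · exact (commute_a_nested (by omega) (by omega) (by omega) (by omega) (by omega)).symm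

theorem atom_mul_atom_of_lt (hpq : p < q) (hrs : r < s)
    (h : p ∈ Set.Ioc r s ↔ q ∈ Set.Ioc r s) :
    atom n p q * atom n r s = atom n (swap p q r) (swap p q s) * atom n p q := by
  have hq := q.2
  have hs := s.2
  rcases eq_or_ne p r with rfl | hpr
  · have hsq : s < q := lt_of_not_ge fun hqs => lt_irrefl p (h.2 ⟨hpq, hqs⟩).1
    rw [swap_apply_left, swap_apply_of_ne_of_ne hrs.ne' hsq.ne, atom_comm q s, atom_of_lt hpq,
      atom_of_lt hrs, atom_of_lt hsq]
    rw [Fin.lt_def] at *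
    rw [a_mul_a_right (by omega) (by omega) (by omega) (by omega)]
    exact (a_mul_a_left (by omega) (by omega)).symm
  rcases eq_or_ne q s with rfl | hqs
  · have hrp : r < p := (h.2 ⟨hrs, le_rfl⟩).1
    rw [swap_apply_right, swap_apply_of_ne_of_ne hrp.ne hrs.ne, atom_of_lt hpq, atom_of_lt hrs,
      atom_of_lt hrp]
    rw [Fin.lt_def] at *
    exact a_mul_a_right (by omega) (by omega) (by omega) (by omega)
  rcases eq_or_ne q r with rfl | hqr
  · rw [swap_apply_right, swap_apply_of_ne_of_ne (hpq.trans hrs).ne' hrs.ne', atom_of_lt hpq,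
      atom_of_lt hrs, atom_of_lt (hpq.trans hrs)]
    rw [Fin.lt_def] at *
    exact a_mul_a_left (by omega) (by omega)
  have hps : p ≠ s := by
    rintro rfl
    exact not_le.2 hpq (h.1 ⟨hrs, le_rfl⟩).2
  rw [swap_apply_of_ne_of_ne hpr.symm hqr.symm, swap_apply_of_ne_of_ne hps.symm hqs.symm]
  exact commute_atom hpq hrs hpr hps hqr hqs h

theorem atom_mul_atom (hpq : p ≠ q) (hrs : r < s)
    (h : (finRotate (n + 1) * swap r s).SameCycle p q) :
    atom n p q * atom n r s = atom n (swap p q r) (swap p q s) * atom n p q := by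
  rcases lt_or_gt_of_ne hpq with hlt | hgt
  · exact atom_mul_atom_of_lt hlt hrs (mem_Ioc_iff_of_sameCycle hrs h)
  · rw [swap_comm, atom_comm p q]
    exact atom_mul_atom_of_lt hgt hrs (mem_Ioc_iff_of_sameCycle hrs h).symm

theorem hurwitzRel_atom : HurwitzRel (finRotate (n + 1)) (atom n) where
  comm := atom_comm
  rel {p q r s} hpq hrs hle hc := by
    have hsame : (finRotate (n + 1) * swap r s).SameCycle p q :=
      swap_le_iff.1 ((le_mul_swap_iff (swap_le_finRotate r s)).2 ⟨hle, hc⟩)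
    rcases lt_or_gt_of_ne hrs with hlt | hgt
    · exact atom_mul_atom hpq hlt hsame
    · rw [atom_comm r s, atom_comm (swap p q r)]
      exact atom_mul_atom hpq hgt (swap_comm r s ▸ hsame)

end Atom

section OfHurwitz

variable {n : ℕ} {G : Type*} [Group G] {A : Fin (n + 1) → Fin (n + 1) → G}
  {p q r s : Fin (n + 1)} (hA : HurwitzRel (finRotate (n + 1)) A)

include hA

theorem mul_eq_of_sameCycle (hpq : p ≠ q) (hrs : r ≠ s)
    (h : (finRotate (n + 1) * swap r s).SameCycle p q) :
    A p q * A r s = A (swap p q r) (swap p q s) * A p q :=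
  have hle := swap_mul_swap_le (swap_le_finRotate r s) h
  hA.rel hpq hrs hle.1 hle.2

theorem mul_eq_of_val_eq_succ (hpq : q.1 = p.1 + 1) (hpr : p ≠ r) (hqr : q ≠ r) :
    A p q * A q r = A p r * A p q := by
  have hne : p ≠ q := by rw [Ne, Fin.ext_iff]; omega
  have h := mul_eq_of_sameCycle hA hne hqr (sameCycle_finRotate_mul_swap hpq hne hpr)
  rwa [swap_apply_right, swap_apply_of_ne_of_ne hpr.symm hqr.symm] at h

theorem braid_of_val_eq_succ (hpq : q.1 = p.1 + 1) (hqr : r.1 = q.1 + 1) :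
    A p q * A q r * A p q = A q r * A p q * A q r := by
  have hne₁ : p ≠ q := by rw [Ne, Fin.ext_iff]; omega
  have hne₂ : q ≠ r := by rw [Ne, Fin.ext_iff]; omega
  have hne₃ : p ≠ r := by rw [Ne, Fin.ext_iff]; omega
  have hleft := mul_eq_of_val_eq_succ hA hpq hne₃ hne₂
  have hright := mul_eq_of_sameCycle hA hne₃ hne₁
    ⟨1, by rw [zpow_one, Perm.mul_apply, swap_apply_left, finRotate_of_val_eq_succ hqr]⟩
  rw [swap_apply_left, swap_apply_of_ne_of_ne hne₁.symm hne₂, hA.comm r q] at hright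
  rw [hleft, hright, mul_assoc, ← hleft, mul_assoc]

theorem commute_of_val_eq_succ (hpq : q.1 = p.1 + 1) (hqr : q.1 < r.1) (hrs : s.1 = r.1 + 1) :
    A p q * A r s = A r s * A p q := by
  have hpr : p ≠ r := by rw [Ne, Fin.ext_iff]; omega
  have hps : p ≠ s := by rw [Ne, Fin.ext_iff]; omega
  have hqr' : q ≠ r := by rw [Ne, Fin.ext_iff]; omega
  have hqs : q ≠ s := by rw [Ne, Fin.ext_iff]; omega
  have h := mul_eq_of_sameCycle hA (by rw [Ne, Fin.ext_iff]; omega)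
    (by rw [Ne, Fin.ext_iff]; omega) (sameCycle_finRotate_mul_swap hpq hpr hps)
  rwa [swap_apply_of_ne_of_ne hpr.symm hqr'.symm, swap_apply_of_ne_of_ne hps.symm hqs.symm] at h

/-- The representation of `B_{n+1}` that sends `a_{p+1,q+1}` to `A p q`, for elements `A p q` of a
group that satisfy the Hurwitz relations of the `n + 1`-cycle. -/
def ofHurwitz : ArtinBraid (n + 1) →* G :=
  PresentedGroup.toGroup
    (f := fun i => A ⟨i.1 - 1, by have := i.2; omega⟩ ⟨i.1, i.2.2⟩) (by
    rintro _ (⟨i, j, h⟩ | ⟨i, j, h⟩)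
    · have := i.2
      simp only [map_mul, map_inv, FreeGroup.lift_apply_of]
      exact mul_inv_eq_one.2 (commute_of_val_eq_succ hA (by simp only; omega) (by simp only; omega)
        (by simp only; omega))
    · have := i.2
      have hj : (⟨j.1 - 1, by have := j.2; omega⟩ : Fin (n + 1)) = ⟨i.1, i.2.2⟩ := by
        ext
        simp only
        omega
      simp only [map_mul, map_inv, FreeGroup.lift_apply_of, hj]
      exact mul_inv_eq_one.2 (braid_of_val_eq_succ hA (by simp only; omega) (by simp only; omega)))

theorem ofHurwitz_sigma {i : ℕ} (h : i + 1 < n + 1) :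
    ofHurwitz hA (sigma (n + 1) (i + 1)) = A ⟨i, by omega⟩ ⟨i + 1, h⟩ := by
  have hi : 1 ≤ i + 1 ∧ i + 1 < n + 1 := ⟨by omega, h⟩
  rw [sigma, dif_pos hi, ofHurwitz, PresentedGroup.toGroup.of]
  rfl

theorem ofHurwitz_a {p q : ℕ} (hpq : p < q) (hq : q < n + 1) :
    ofHurwitz hA (a (n + 1) (p + 1) (q + 1)) = A ⟨p, by omega⟩ ⟨q, hq⟩ := by
  obtain ⟨k, rfl⟩ := Nat.exists_eq_add_of_lt hpq
  induction k generalizing p with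
  | zero => rw [a_succ_self, ofHurwitz_sigma hA hq]
  | succ k ih =>
    have hstep := mul_eq_of_val_eq_succ hA (p := ⟨p, by omega⟩) (q := ⟨p + 1, by omega⟩)
      (r := ⟨p + (k + 1) + 1, hq⟩) rfl (by rw [Ne, Fin.ext_iff]; simp only; omega)
      (by rw [Ne, Fin.ext_iff]; simp only; omega)
    have hnext := ih (p := p + 1) (by omega) (by omega)
    simp only [show p + 1 + k + 1 = p + (k + 1) + 1 by omega] at hnext
    rw [a_eq_sigma_conj (by omega), map_mul, map_mul, map_inv, ofHurwitz_sigma hA (by omega),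
      hnext, hstep, mul_inv_cancel_right]

theorem ofHurwitz_atom (h : p ≠ q) : ofHurwitz hA (atom n p q) = A p q := by
  rcases lt_or_gt_of_ne h with hlt | hgt
  · rw [atom_of_lt hlt, ofHurwitz_a hA hlt q.2]
  · rw [atom_comm, atom_of_lt hgt, ofHurwitz_a hA hgt p.2, hA.comm]

end OfHurwitz

theorem isIntervalGroup_lift_atom (n : ℕ) :
    IsIntervalGroup (finRotate (n + 1)) (lift (atom n)) where
  isIntervalHom := isIntervalHom_lift hurwitzRel_atom
  exists_lift _ hF := ⟨ofHurwitz hF.hurwitzRel, fun w hw =>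
    (isLift_lift (atom n) w).map_eq hF _ (fun _ _ hpq _ => ofHurwitz_atom _ hpq) hw⟩

end ArtinBraid

namespace AbsoluteLength

open Equiv

theorem simpleMonoid_lift {α G : Type*} [Fintype α] [DecidableEq α] [Group G] {c d : Perm α}
    {A : α → α → G} (hA : HurwitzRel c A) (hd : d ≼ c) :
    simpleMonoid (lift A) d = Submonoid.closure {x | ∃ p q, p ≠ q ∧ swap p q ≼ d ∧ x = A p q} := by
  refine le_antisymm (Submonoid.closure_le.2 ?_) (Submonoid.closure_le.2 ?_)
  · rintro _ ⟨w, hw, rfl⟩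
    exact (isLift_lift A w).mem fun p q hpq hle =>
      Submonoid.subset_closure ⟨p, q, hpq, hle.trans hw, rfl⟩
  · rintro _ ⟨p, q, hpq, hle, rfl⟩
    rw [← lift_swap hA hpq (hle.trans hd)]
    exact lift_mem_simpleMonoid hle

end AbsoluteLength

namespace ArtinBraid

open Equiv AbsoluteLength

section Parabolic

variable {n : ℕ} {p q : Fin (n + 2)}

theorem exists_a_iff {m : ℕ} (hm : m ≤ n + 1) {x : ArtinBraid (n + 1)} :
    (∃ p q : ℕ, 1 ≤ p ∧ p < q ∧ q ≤ m ∧ x = a (n + 1) p q) ↔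
      ∃ p q : Fin (n + 1), p ≠ q ∧ (p.1 < m ∧ q.1 < m) ∧ x = atom n p q := by
  constructor
  · rintro ⟨p, q, hp, hpq, hq, rfl⟩
    have hlt : (⟨p - 1, by omega⟩ : Fin (n + 1)) < ⟨q - 1, by omega⟩ := by
      rw [Fin.mk_lt_mk]; omega
    refine ⟨_, _, hlt.ne, ⟨by simp only; omega, by simp only; omega⟩, ?_⟩
    rw [atom_of_lt hlt, Nat.sub_add_cancel hp, Nat.sub_add_cancel (hp.trans hpq.le)]
  · rintro ⟨p, q, hpq, hm, rfl⟩
    rcases lt_or_gt_of_ne hpq with h | h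
    · exact ⟨_, _, by omega, Nat.succ_lt_succ h, hm.2, atom_of_lt h⟩
    · exact ⟨_, _, by omega, Nat.succ_lt_succ h, hm.1, by rw [atom_comm, atom_of_lt h]⟩

theorem simpleMonoid_finRotate (n : ℕ) :
    simpleMonoid (lift (atom n)) (finRotate (n + 1)) = BKL (n + 1) := by
  rw [simpleMonoid_lift hurwitzRel_atom (.refl _), BKL]
  congr 1
  ext x
  simp only [Set.mem_ofPred_eq, swap_le_finRotate, exists_a_iff le_rfl, Fin.is_lt, and_self]

/-- The cycle `(0 1 ⋯ n)` on the points `0, …, n + 1`. -/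
def innerCycle (n : ℕ) : Perm (Fin (n + 2)) :=
  finRotate (n + 2) * swap ⟨n, by omega⟩ (Fin.last (n + 1))

theorem innerCycle_le (n : ℕ) : innerCycle n ≼ finRotate (n + 2) :=
  mul_swap_le (swap_le_finRotate _ _)

theorem innerCycle_last (n : ℕ) : innerCycle n (Fin.last (n + 1)) = Fin.last (n + 1) := by
  rw [innerCycle, Perm.mul_apply, swap_apply_right, finRotate_of_val_eq_succ]
  rfl

theorem sameCycle_innerCycle_zero (hp : p.1 < n + 1) : (innerCycle n).SameCycle 0 p := by
  obtain ⟨k, hk⟩ := p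
  induction k with
  | zero => rfl
  | succ k ih =>
    refine (ih (by omega) (by simp only at hp ⊢; omega)).trans
      (sameCycle_finRotate_mul_swap rfl ?_ ?_) <;>
      simp only [Ne, Fin.ext_iff, Fin.val_last] at hp ⊢ <;> omega

theorem swap_le_innerCycle (h : p ≠ q) :
    swap p q ≼ innerCycle n ↔ p.1 < n + 1 ∧ q.1 < n + 1 := by
  rw [swap_le_iff]
  refine ⟨fun hpq => ?_, fun ⟨hp, hq⟩ =>
    (sameCycle_innerCycle_zero hp).symm.trans (sameCycle_innerCycle_zero hq)⟩
  have hlast : (p = Fin.last (n + 1)) = (q = Fin.last (n + 1)) :=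
    eq_of_sameCycle (f := (· = Fin.last (n + 1)))
      (fun i => by
        rw [eq_iff_iff]
        nth_rw 1 [← innerCycle_last, (innerCycle n).injective.eq_iff]) hpq
  have hne : p ≠ Fin.last (n + 1) := fun hp => h (hp.trans (hlast.mp hp).symm)
  exact ⟨Fin.val_lt_last hne, Fin.val_lt_last fun hq => hne (hlast.mpr hq)⟩

theorem simpleMonoid_innerCycle (n : ℕ) :
    simpleMonoid (lift (atom (n + 1))) (innerCycle n) = (BKL (n + 1)).map (incl (n + 1)) := by
  rw [simpleMonoid_lift hurwitzRel_atom (innerCycle_le n), BKL, MonoidHom.map_mclosure]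
  congr 1
  ext x
  rw [Set.mem_ofPred_eq, exists₂_congr fun p q => and_congr_right fun hpq =>
    and_congr_left fun _ => swap_le_innerCycle hpq, ← exists_a_iff (by omega)]
  constructor
  · rintro ⟨p, q, hp, hpq, hq, rfl⟩
    exact ⟨_, ⟨p, q, hp, hpq, hq, rfl⟩, incl_a _ hp hpq hq⟩
  · rintro ⟨_, ⟨p, q, hp, hpq, hq, rfl⟩, rfl⟩
    exact ⟨p, q, hp, hpq, hq, incl_a _ hp hpq hq⟩

end Parabolic

section ExponentSum

variable {n : ℕ} {β : ArtinBraid n}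

/-- The homomorphism that sends each generator `σ_i` to `1`. -/
def expSumHom (n : ℕ) : ArtinBraid n →* Multiplicative ℤ :=
  PresentedGroup.toGroup (f := fun _ => Multiplicative.ofAdd 1) (by
    rintro _ (⟨i, j, -⟩ | ⟨i, j, -⟩) <;>
    · simp only [map_mul, map_inv, FreeGroup.lift_apply_of]
      exact mul_inv_cancel _)

/-- The exponent sum of a braid, which serves as the length of the elements of `BKL_n`. -/
def expSum (β : ArtinBraid n) : ℤ := (expSumHom n β).toAdd

theorem expSum_one : expSum (1 : ArtinBraid n) = 0 := rfl

theorem expSum_mul (β γ : ArtinBraid n) : expSum (β * γ) = expSum β + expSum γ := by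
  rw [expSum, map_mul, toAdd_mul, expSum, expSum]

theorem expSum_conj (β γ : ArtinBraid n) : expSum (γ * β * γ⁻¹) = expSum β := by
  have h := expSum_mul (γ * β * γ⁻¹) γ
  rw [inv_mul_cancel_right, expSum_mul] at h
  omega

theorem expSum_sigma {i : ℕ} (h : 1 ≤ i ∧ i < n) : expSum (sigma n i) = 1 := by
  rw [expSum, sigma, dif_pos h, expSumHom, PresentedGroup.toGroup.of, toAdd_ofAdd]

theorem expSum_a {p q : ℕ} (hp : 1 ≤ p) (hpq : p < q) (hq : q ≤ n) : expSum (a n p q) = 1 := by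
  rw [a, expSum_conj, expSum_sigma ⟨by omega, by omega⟩]

theorem expSum_phi (β : ArtinBraid n) : expSum (phi n β) = expSum β := expSum_conj _ _

theorem expSum_nonneg (h : β ∈ BKL n) : 0 ≤ expSum β := by
  induction h using Submonoid.closure_induction with
  | mem x hx =>
    obtain ⟨p, q, hp, hpq, hq, rfl⟩ := hx
    rw [expSum_a hp hpq hq]
    exact zero_le_one
  | one => exact le_rfl
  | mul x y _ _ hx hy =>
    rw [expSum_mul]
    exact add_nonneg hx hy

theorem eq_one_or_exists_eq_mul_a (h : β ∈ BKL n) : β = 1 ∨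
    ∃ γ ∈ BKL n, ∃ p q, 1 ≤ p ∧ p < q ∧ q ≤ n ∧ β = γ * a n p q := by
  induction h using Submonoid.closure_induction_right with
  | one => exact .inl rfl
  | mul_right x hx y hy _ =>
    obtain ⟨p, q, hp, hpq, hq, rfl⟩ := hy
    exact .inr ⟨x, hx, p, q, hp, hpq, hq, rfl⟩

theorem expSum_eq_zero_iff (h : β ∈ BKL n) : expSum β = 0 ↔ β = 1 := by
  refine ⟨fun h0 => ?_, fun h1 => by rw [h1, expSum_one]⟩
  rcases eq_one_or_exists_eq_mul_a h with h1 | ⟨γ, hγ, p, q, hp, hpq, hq, rfl⟩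
  · exact h1
  · have := expSum_nonneg hγ
    rw [expSum_mul, expSum_a hp hpq hq] at h0
    omega

theorem expSum_incl (β : ArtinBraid n) : expSum (incl n β) = expSum β := by
  have h : (expSumHom (n + 1)).comp (incl n) = expSumHom n := by
    ext i
    change expSum (incl n (PresentedGroup.of i)) = expSum (PresentedGroup.of i)
    have hi : sigma n i.1 = PresentedGroup.of i := dif_pos i.2
    rw [← hi, incl_sigma n i.2, expSum_sigma i.2, expSum_sigma ⟨i.2.1, i.2.2.trans (by omega)⟩]
  exact congrArg Multiplicative.toAdd (DFunLike.congr_fun h β)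

end ExponentSum

section ForgetStrand

variable {n : ℕ}

/-- The braid obtained from `σ_i` by forgetting the strand at the position `k`, where the positions
are numbered from `1` to `n + 1`. The other values of `k` are assigned the trivial braid. -/
def sigmaForget (n i k : ℕ) : ArtinBraid n :=
  if 1 ≤ k ∧ k < i then sigma n (i - 1) else if i + 1 < k ∧ k ≤ n + 1 then sigma n i else 1

theorem sigmaForget_of_lt {i k : ℕ} (h : 1 ≤ k ∧ k < i) : sigmaForget n i k = sigma n (i - 1) :=
  if_pos h

theorem sigmaForget_of_gt {i k : ℕ} (h : i + 1 < k ∧ k ≤ n + 1) :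
    sigmaForget n i k = sigma n i := by
  rw [sigmaForget, if_neg (by omega), if_pos h]

theorem sigmaForget_eq_one {i k : ℕ} (h : ¬(1 ≤ k ∧ k < i)) (h' : ¬(i + 1 < k ∧ k ≤ n + 1)) :
    sigmaForget n i k = 1 := by
  rw [sigmaForget, if_neg h, if_neg h']

/-- The effect of `σ_i` on the pairs that consist of a marked position and of the braid formed by
the strands that do not end at the marked position. -/
def forgetStep (n i : ℕ) : Perm (ℕ × ArtinBraid n) :=
  prodShear (swap i (i + 1)) fun k => Equiv.mulLeft (sigmaForget n i k)

theorem forgetStep_apply (i k : ℕ) (β : ArtinBraid n) :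
    forgetStep n i (k, β) = (swap i (i + 1) k, sigmaForget n i k * β) := rfl

theorem forgetStep_comm {i j : ℕ} (hi : 1 ≤ i) (hij : i + 2 ≤ j) (hj : j < n + 1) :
    forgetStep n i * forgetStep n j = forgetStep n j * forgetStep n i := by
  ext1 ⟨k, β⟩
  rcases (by omega : (k = 0 ∨ n + 1 < k) ∨ (1 ≤ k ∧ k < i) ∨ k = i ∨ k = i + 1 ∨
    (i + 1 < k ∧ k < j) ∨ k = j ∨ k = j + 1 ∨ (j + 1 < k ∧ k ≤ n + 1)) with
    h | h | rfl | rfl | h | rfl | rfl | h <;>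
  simp (disch := omega) only [Perm.mul_apply, forgetStep_apply, swap_apply_left, swap_apply_right,
    swap_apply_of_ne_of_ne, sigmaForget_of_lt, sigmaForget_of_gt, sigmaForget_eq_one, one_mul,
    ← mul_assoc]
  · rw [(commute_sigma (by omega : i - 1 + 2 ≤ j - 1)).eq]
  · rw [(commute_sigma (by omega : i + 2 ≤ j - 1)).eq]
  · rw [(commute_sigma hij).eq]

theorem forgetStep_braid {i : ℕ} (hi : 1 ≤ i) (hin : i + 1 < n + 1) :
    forgetStep n i * forgetStep n (i + 1) * forgetStep n i =
      forgetStep n (i + 1) * forgetStep n i * forgetStep n (i + 1) := by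
  ext1 ⟨k, β⟩
  rcases (by omega : (k = 0 ∨ n + 1 < k) ∨ (1 ≤ k ∧ k < i) ∨ k = i ∨ k = i + 1 ∨ k = i + 1 + 1 ∨
    (i + 1 + 1 < k ∧ k ≤ n + 1)) with h | h | rfl | rfl | rfl | h <;>
  simp (disch := omega) only [Perm.mul_apply, forgetStep_apply, swap_apply_left, swap_apply_right,
    swap_apply_of_ne_of_ne, sigmaForget_of_lt, sigmaForget_of_gt, sigmaForget_eq_one, one_mul,
    Nat.add_sub_cancel, ← mul_assoc]
  · obtain ⟨i, rfl⟩ := Nat.exists_eq_add_of_le' hi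
    rw [Nat.add_sub_cancel, sigma_braid n (by omega) (by omega)]
  · rw [sigma_braid n hi (by omega)]

/-- The action of the braids on `n + 1` strands on the pairs that consist of a marked position and
of a braid on the `n` other strands. -/
def forgetStrand (n : ℕ) : ArtinBraid (n + 1) →* Perm (ℕ × ArtinBraid n) :=
  PresentedGroup.toGroup (f := fun i => forgetStep n i.1) (by
    rintro _ (⟨i, j, h⟩ | ⟨i, j, h⟩)
    · simp only [map_mul, map_inv, FreeGroup.lift_apply_of]
      exact mul_inv_eq_one.2 (forgetStep_comm i.2.1 h j.2.2)
    · simp only [map_mul, map_inv, FreeGroup.lift_apply_of, h]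
      exact mul_inv_eq_one.2 (forgetStep_braid i.2.1 (h ▸ j.2.2)))

theorem forgetStrand_sigma {i : ℕ} (h : 1 ≤ i ∧ i < n + 1) :
    forgetStrand n (sigma (n + 1) i) = forgetStep n i := by
  rw [sigma, dif_pos h, forgetStrand, PresentedGroup.toGroup.of]

theorem forgetStrand_incl (β γ : ArtinBraid n) :
    forgetStrand n (incl n β) (n + 1, γ) = (n + 1, β * γ) := by
  have h : β ∈ Subgroup.closure (Set.range (PresentedGroup.of
      (rels := {r : FreeGroup {i : ℕ // 1 ≤ i ∧ i < n} | ArtinRel n r}))) := by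
    rw [PresentedGroup.closure_range_of]
    exact Subgroup.mem_top β
  induction h using Subgroup.closure_induction generalizing γ with
  | mem x hx =>
    obtain ⟨i, rfl⟩ := hx
    have hi : sigma n i.1 = PresentedGroup.of i := dif_pos i.2
    have := i.2
    rw [← hi, incl_sigma n i.2, forgetStrand_sigma (by omega), forgetStep_apply,
      swap_apply_of_ne_of_ne (by omega) (by omega), sigmaForget_of_gt (by omega)]
  | one => rw [map_one, map_one, Perm.one_apply, one_mul]
  | mul x y _ _ hx hy => rw [map_mul, map_mul, Perm.mul_apply, hy, hx, mul_assoc]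
  | inv x _ hx => rw [map_inv, map_inv, Perm.inv_eq_iff_eq, hx, mul_inv_cancel_left]

theorem incl_injective : Function.Injective (incl n) := by
  intro β γ h
  have h' := forgetStrand_incl β 1
  rw [h, forgetStrand_incl, Prod.mk.injEq, mul_one, mul_one] at h'
  exact h'.2.symm

theorem sigma_last_ne_incl (hn : 1 ≤ n) (β : ArtinBraid n) : sigma (n + 1) n ≠ incl n β := by
  intro h
  have h' := forgetStrand_incl β 1
  rw [← h, forgetStrand_sigma (by omega), forgetStep_apply, swap_apply_right, Prod.mk.injEq] at h'
  omega

end ForgetStrand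

end ArtinBraid

namespace BKL

open ArtinBraid AbsoluteLength

section Tail

variable {n : ℕ}

theorem coe_incl (β : BKL n) : (incl n β : ArtinBraid (n + 1)) = ArtinBraid.incl n β := rfl

theorem incl_injective : Function.Injective (incl n) := fun _ _ h =>
  Subtype.ext (ArtinBraid.incl_injective (congrArg Subtype.val h))

theorem eq_one_of_expSum_eq_zero {β : BKL n} (h : expSum (β : ArtinBraid n) = 0) : β = 1 :=
  Subtype.ext ((expSum_eq_zero_iff β.2).1 h)

theorem RightDvd.antisymm {x y : BKL n} (hxy : RightDvd n x y) (hyx : RightDvd n y x) : x = y := by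
  obtain ⟨u, hu, hy⟩ := hxy
  obtain ⟨v, hv, hx⟩ := hyx
  have hu0 : expSum u = 0 := by
    have := expSum_nonneg hu
    have := expSum_nonneg hv
    have := congrArg expSum hy
    have := congrArg expSum hx
    rw [expSum_mul] at *
    omega
  rw [(expSum_eq_zero_iff hu).1 hu0, one_mul] at hy
  exact Subtype.ext hy.symm

theorem RightDvd.refl (x : ArtinBraid n) : RightDvd n x x := IsRightDivisor.refl x

theorem eq_one_of_rightDvd_one {x : BKL n} (h : RightDvd n x 1) : x = 1 :=
  h.antisymm ⟨x, x.2, (mul_one _).symm⟩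

theorem isTail_iff {β : ArtinBraid (n + 1)} {τ : BKL n} :
    IsTail n β τ ↔
      IsMaxRightDivisor ((BKL n).map (ArtinBraid.incl n)) (BKL (n + 1)) (incl n τ) β := by
  constructor
  · refine fun h => ⟨⟨τ, τ.2, rfl⟩, h.1, ?_⟩
    rintro _ ⟨x, hx, rfl⟩ hxβ
    obtain ⟨u, hu, hτ⟩ := h.2 ⟨x, hx⟩ hxβ
    exact ⟨ArtinBraid.incl n u, ⟨u, hu, rfl⟩, by rw [coe_incl, hτ, map_mul]⟩
  · refine fun h => ⟨h.isRightDivisor, fun x hxβ => ?_⟩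
    obtain ⟨_, ⟨u, hu, rfl⟩, hτ⟩ := h.of_isRightDivisor _ ⟨x, x.2, rfl⟩ hxβ
    exact ⟨u, hu, ArtinBraid.incl_injective (by rw [map_mul]; exact hτ)⟩

theorem exists_isTail {β : ArtinBraid (n + 2)} (hβ : β ∈ BKL (n + 2)) :
    ∃ τ, IsTail (n + 1) β τ := by
  rw [← simpleMonoid_finRotate] at hβ
  obtain ⟨_, hτ⟩ := (isIntervalGroup_lift_atom (n + 1)).exists_tail (innerCycle_le n) hβ
  rw [simpleMonoid_finRotate, simpleMonoid_innerCycle] at hτ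
  obtain ⟨τ, hτ', rfl⟩ := hτ.mem
  exact ⟨⟨τ, hτ'⟩, isTail_iff.2 hτ⟩

theorem IsTail.unique {β : ArtinBraid (n + 1)} {x y : BKL n} (hx : IsTail n β x)
    (hy : IsTail n β y) : x = y :=
  (hy.2 x hx.1).antisymm (hx.2 y hy.1)

theorem IsTail.mul_incl {γ : ArtinBraid (n + 2)} (h : IsTail (n + 1) γ 1) (x : BKL (n + 1)) :
    IsTail (n + 1) (γ * incl (n + 1) x) x := by
  have hγ : γ ∈ BKL (n + 2) := by
    obtain ⟨γ', hγ', hγ⟩ := h.1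
    rwa [hγ, map_one, Submonoid.coe_one, mul_one]
  obtain ⟨z, hz⟩ := exists_isTail (mul_mem hγ (incl (n + 1) x).2)
  have hx := (isTail_iff.1 h).mul_right hγ ⟨x, x.2, rfl⟩ (isTail_iff.1 hz)
  rw [map_one, Submonoid.coe_one, one_mul] at hx
  exact isTail_iff.2 hx

theorem IsTail.of_mul_incl {γ : ArtinBraid (n + 1)} {x : BKL n} (hγ : γ ∈ BKL (n + 1))
    (h : IsTail n (γ * incl n x) x) : IsTail n γ 1 := by
  refine ⟨⟨γ, hγ, by rw [map_one, Submonoid.coe_one, mul_one]⟩, ?_⟩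
  rintro y ⟨δ, hδ, rfl⟩
  obtain ⟨u, hu, hx⟩ := h.2 (y * x) ⟨δ, hδ, by rw [map_mul, Submonoid.coe_mul, mul_assoc]⟩
  refine ⟨u, hu, ?_⟩
  rw [Submonoid.coe_mul, ← mul_assoc, eq_comm, mul_eq_right] at hx
  exact hx.symm

end Tail

section Rotation

variable {n : ℕ}

theorem phi_mem {β : ArtinBraid n} (h : β ∈ BKL n) : phi n β ∈ BKL n := by
  suffices hle : BKL n ≤ (BKL n).comap (phi n).toMonoidHom from hle h
  refine Submonoid.closure_le.2 ?_
  rintro _ ⟨p, q, hp, hpq, hq, rfl⟩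
  apply Submonoid.subset_closure
  rcases hq.lt_or_eq with hqn | rfl
  · exact ⟨p + 1, q + 1, by omega, by omega, by omega, phi_a hp hpq hqn⟩
  · exact ⟨1, p + 1, by omega, by omega, by omega, phi_a_last hp hpq⟩

theorem phi_symm_a {p q : ℕ} (hp : 1 ≤ p) (hpq : p < q) (hq : q < n) :
    (phi n).symm (a n (p + 1) (q + 1)) = a n p q :=
  (phi n).symm_apply_eq.2 (phi_a hp hpq hq).symm

theorem phi_symm_a_one {q : ℕ} (hq : 1 ≤ q) (hqn : q < n) :
    (phi n).symm (a n 1 (q + 1)) = a n q n :=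
  (phi n).symm_apply_eq.2 (phi_a_last hq hqn).symm

theorem phi_symm_mem {β : ArtinBraid n} (h : β ∈ BKL n) : (phi n).symm β ∈ BKL n := by
  suffices hle : BKL n ≤ (BKL n).comap (phi n).symm.toMonoidHom from hle h
  refine Submonoid.closure_le.2 ?_
  rintro _ ⟨p, q, hp, hpq, hq, rfl⟩
  apply Submonoid.subset_closure
  obtain ⟨q, rfl⟩ := Nat.exists_eq_add_of_le' (hp.trans hpq.le)
  rcases hp.eq_or_lt with rfl | hp
  · exact ⟨q, n, by omega, by omega, le_rfl, phi_symm_a_one (by omega) (by omega)⟩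
  · obtain ⟨p, rfl⟩ := Nat.exists_eq_add_of_le' hp.le
    exact ⟨p, q, by omega, by omega, by omega, phi_symm_a (by omega) (by omega) (by omega)⟩

theorem expSum_phi_symm (β : ArtinBraid n) : expSum ((phi n).symm β) = expSum β := by
  rw [← expSum_phi, MulEquiv.apply_symm_apply]

theorem rotProd_append (s : List (BKL n)) (x : BKL n) :
    rotProd n (s ++ [x]) = phi (n + 1) (rotProd n s) * incl n x := by
  induction s with
  | nil => simp only [List.nil_append, rotProd, List.length_nil, pow_zero, MulAut.one_apply,
      mul_one, map_one, one_mul]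
  | cons β s ih =>
    rw [List.cons_append, rotProd, ih, rotProd, map_mul, List.length_append, List.length_singleton,
      pow_succ', MulAut.mul_apply, mul_assoc]

theorem expSum_rotProd_append (s : List (BKL n)) (x : BKL n) :
    expSum (rotProd n (s ++ [x])) = expSum (rotProd n s) + expSum (x : ArtinBraid n) := by
  rw [rotProd_append, expSum_mul, expSum_phi, coe_incl, expSum_incl]

theorem rotProd_mem (s : List (BKL n)) : rotProd n s ∈ BKL (n + 1) := by
  induction s using List.reverseRecOn with
  | nil => exact one_mem _
  | append_singleton s x ih =>
    rw [rotProd_append]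
    exact mul_mem (phi_mem ih) (incl n x).2

end Rotation

section Uniqueness

variable {n : ℕ}

/-- The sequences of the form `(β_b, …, β_{k+1})` with `1 ≤ k ≤ b`, for a splitting
`(β_b, …, β_1)` of some element of `BKL_{n+1}`: removing at least the last entry turns the clause
about `1` in `IsSplitting` into the uniform condition that the first entry is not `1`. -/
def IsReduced (n : ℕ) (s : List (BKL n)) : Prop :=
  s.head? ≠ some 1 ∧ ∀ j < s.length, IsTail n (phi (n + 1) (rotProd n (s.take j))) 1

theorem forall_isTail_take_append {s : List (BKL n)} {x : BKL n} :
    (∀ j < (s ++ [x]).length, IsTail n (phi (n + 1) (rotProd n ((s ++ [x]).take j))) 1) ↔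
      (∀ j < s.length, IsTail n (phi (n + 1) (rotProd n (s.take j))) 1) ∧
      IsTail n (phi (n + 1) (rotProd n s)) 1 := by
  rw [List.length_append, List.length_singleton, Nat.forall_lt_succ_right, List.take_left]
  exact and_congr_left fun _ => forall₂_congr fun j hj => by
    rw [List.take_append_of_le_length hj.le]

theorem isReduced_nil : IsReduced n [] :=
  ⟨Option.some_ne_none 1 |>.symm, fun _ hj => absurd hj (Nat.not_lt_zero _)⟩

theorem isReduced_append {s : List (BKL n)} {x : BKL n} :
    IsReduced n (s ++ [x]) ↔ IsReduced n s ∧ IsTail n (phi (n + 1) (rotProd n s)) 1 ∧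
      (s = [] → x ≠ 1) := by
  have head_iff : (s ++ [x]).head? ≠ some 1 ↔ s.head? ≠ some 1 ∧ (s = [] → x ≠ 1) := by
    cases s <;> simp
  rw [IsReduced, forall_isTail_take_append, head_iff, IsReduced]
  tauto

theorem isSplitting_append {β : BKL (n + 1)} {s : List (BKL n)} {x : BKL n} :
    IsSplitting n β (s ++ [x]) ↔ IsReduced n s ∧ IsTail n (phi (n + 1) (rotProd n s)) 1 ∧
      (β : ArtinBraid (n + 1)) = phi (n + 1) (rotProd n s) * incl n x := by
  have reindex {m : ℕ} {P : ℕ → Prop} : (∀ k, 1 ≤ k → k ≤ m → P (m - k)) ↔ ∀ j < m, P j := by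
    refine ⟨fun h j hj => ?_, fun h k hk hkm => h _ (by omega)⟩
    have := h (m - j) (by omega) (by omega)
    rwa [Nat.sub_sub_self hj.le] at this
  have head_iff : ((s ++ [x]).head? = some 1 → (s ++ [x]).length = 1) ↔ s.head? ≠ some 1 := by
    cases s <;> simp
  have hne : s ++ [x] ≠ [] := List.append_ne_nil_of_right_ne_nil s (List.cons_ne_nil x [])
  rw [IsSplitting, reindex (P := fun j => IsTail n (phi (n + 1) (rotProd n ((s ++ [x]).take j))) 1),
    forall_isTail_take_append, head_iff, rotProd_append, IsReduced]
  tauto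

theorem IsSplitting.exists_eq_append {β : BKL (n + 1)} {s : List (BKL n)}
    (h : IsSplitting n β s) : ∃ t x, s = t ++ [x] :=
  (List.eq_nil_or_concat' s).resolve_left h.1

theorem IsReduced.expSum_rotProd_pos {s : List (BKL n)} (h : IsReduced n s) (hs : s ≠ []) :
    0 < expSum (rotProd n s) := by
  induction s using List.reverseRecOn with
  | nil => exact absurd rfl hs
  | append_singleton s x ih =>
    obtain ⟨hs, -, hx⟩ := isReduced_append.1 h
    rw [expSum_rotProd_append]
    by_cases hnil : s = []
    · have := mt eq_one_of_expSum_eq_zero (hx hnil)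
      have := expSum_nonneg x.2
      have := expSum_nonneg (rotProd_mem s)
      omega
    · exact add_pos_of_pos_of_nonneg (ih hs hnil) (expSum_nonneg x.2)

theorem IsReduced.rotProd_ne_one {s : List (BKL n)} (h : IsReduced n s) (hs : s ≠ []) :
    rotProd n s ≠ 1 := fun h1 => by
  have := h.expSum_rotProd_pos hs
  rw [h1, expSum_one] at this
  exact this.false

theorem rotProd_eq_and_eq_of_isTail {s t : List (BKL (n + 1))} {x y : BKL (n + 1)}
    (hs : IsTail (n + 1) (phi (n + 2) (rotProd (n + 1) s)) 1)
    (ht : IsTail (n + 1) (phi (n + 2) (rotProd (n + 1) t)) 1)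
    (h : phi (n + 2) (rotProd (n + 1) s) * incl (n + 1) x =
      phi (n + 2) (rotProd (n + 1) t) * incl (n + 1) y) :
    rotProd (n + 1) s = rotProd (n + 1) t ∧ x = y := by
  have hx := hs.mul_incl x
  rw [h] at hx
  obtain rfl := hx.unique (ht.mul_incl y)
  exact ⟨(phi _).injective (mul_right_cancel h), rfl⟩

theorem IsReduced.unique {s t : List (BKL (n + 1))} (hs : IsReduced (n + 1) s)
    (ht : IsReduced (n + 1) t) (h : rotProd (n + 1) s = rotProd (n + 1) t) : s = t := by
  induction s using List.reverseRecOn generalizing t with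
  | nil =>
    by_contra hne
    exact ht.rotProd_ne_one (Ne.symm hne) h.symm
  | append_singleton s x ih =>
    rcases List.eq_nil_or_concat' t with rfl | ⟨t, y, rfl⟩
    · have hne : s ++ [x] ≠ [] := List.append_ne_nil_of_right_ne_nil s (List.cons_ne_nil x [])
      exact absurd h (hs.rotProd_ne_one hne)
    · obtain ⟨hs', hs1, -⟩ := isReduced_append.1 hs
      obtain ⟨ht', ht1, -⟩ := isReduced_append.1 ht
      rw [rotProd_append, rotProd_append] at h
      obtain ⟨hst, rfl⟩ := rotProd_eq_and_eq_of_isTail hs1 ht1 h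
      rw [ih hs' ht' hst]

theorem IsSplitting.unique {β : BKL (n + 2)} {s t : List (BKL (n + 1))}
    (hs : IsSplitting (n + 1) β s) (ht : IsSplitting (n + 1) β t) : s = t := by
  obtain ⟨s, x, rfl⟩ := hs.exists_eq_append
  obtain ⟨t, y, rfl⟩ := ht.exists_eq_append
  obtain ⟨hs', hs1, hsβ⟩ := isSplitting_append.1 hs
  obtain ⟨ht', ht1, htβ⟩ := isSplitting_append.1 ht
  obtain ⟨hst, rfl⟩ := rotProd_eq_and_eq_of_isTail hs1 ht1 (hsβ.symm.trans htβ)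
  rw [hs'.unique ht' hst]

end Uniqueness

section Existence

variable {n : ℕ}

theorem exists_tail_decomposition {β : ArtinBraid (n + 2)} (hβ : β ∈ BKL (n + 2)) :
    ∃ γ ∈ BKL (n + 2), ∃ τ, β = phi (n + 2) γ * incl (n + 1) τ ∧
      IsTail (n + 1) (phi (n + 2) γ) 1 ∧ IsTail (n + 1) β τ := by
  obtain ⟨τ, hτ⟩ := exists_isTail hβ
  obtain ⟨γ, hγ, rfl⟩ := hτ.1
  refine ⟨(phi _).symm γ, phi_symm_mem hγ, τ, ?_, ?_, hτ⟩
  · rw [MulEquiv.apply_symm_apply]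
  · rw [MulEquiv.apply_symm_apply]
    exact .of_mul_incl hγ hτ

theorem exists_rightDvd_mul_a {γ : ArtinBraid (n + 1)} (hγ : γ ∈ BKL (n + 1)) {p q : ℕ}
    (hp : 1 ≤ p) (hpq : p < q) (hq : q ≤ n) :
    ∃ x : BKL n, x ≠ 1 ∧ RightDvd (n + 1) (incl n x) (γ * a (n + 1) p q) := by
  refine ⟨gen n p q hp hpq hq, fun h1 => ?_, γ, hγ, congrArg _ (incl_a n hp hpq hq).symm⟩
  have h : expSum (gen n p q hp hpq hq : ArtinBraid n) = 1 := expSum_a hp hpq hq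
  rw [h1, Submonoid.coe_one, expSum_one] at h
  exact zero_ne_one h

theorem exists_rightDvd_phi_symm_iterate {β : ArtinBraid (n + 3)} (hβ : β ∈ BKL (n + 3))
    (hβ1 : β ≠ 1) : ∃ k, ∃ x : BKL (n + 2), x ≠ 1 ∧
      RightDvd (n + 3) (incl (n + 2) x) ((phi (n + 3)).symm^[k] β) := by
  obtain ⟨γ, hγ, p, q, hp, hpq, hq, rfl⟩ := (eq_one_or_exists_eq_mul_a hβ).resolve_left hβ1
  rcases hq.lt_or_eq with hq | rfl
  · exact ⟨0, exists_rightDvd_mul_a hγ hp hpq (by omega)⟩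
  rcases hp.eq_or_lt with rfl | hp
  · refine ⟨2, ?_⟩
    rw [Function.iterate_succ_apply, Function.iterate_one, map_mul, map_mul,
      phi_symm_a_one (by omega) (by omega), phi_symm_a (by omega) (by omega) (by omega)]
    exact exists_rightDvd_mul_a (phi_symm_mem (phi_symm_mem hγ)) (by omega) (by omega) le_rfl
  · obtain ⟨p, rfl⟩ := Nat.exists_eq_add_of_le' hp.le
    refine ⟨1, ?_⟩
    rw [Function.iterate_one, map_mul, phi_symm_a (by omega) (by omega) (by omega)]
    exact exists_rightDvd_mul_a (phi_symm_mem hγ) (by omega) (by omega) le_rfl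

theorem exists_isReduced_of_eq_phi_mul {β γ : ArtinBraid (n + 1)} {τ : BKL n} (hβ1 : β ≠ 1)
    (hβ : β = phi (n + 1) γ * incl n τ) (hγ1 : IsTail n (phi (n + 1) γ) 1)
    (hγ : ∃ s, IsReduced n s ∧ rotProd n s = γ) : ∃ s, IsReduced n s ∧ rotProd n s = β := by
  obtain ⟨s, hs, rfl⟩ := hγ
  refine ⟨s ++ [τ], isReduced_append.2 ⟨hs, hγ1, ?_⟩, (rotProd_append s τ).trans hβ.symm⟩
  rintro rfl rfl
  exact hβ1 (by rw [hβ, rotProd, map_one, map_one, Submonoid.coe_one, mul_one])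

theorem exists_isReduced_of_phi_symm_or_rightDvd {β : ArtinBraid (n + 2)} (hβ : β ∈ BKL (n + 2))
    (hβ1 : β ≠ 1)
    (ih : ∀ γ ∈ BKL (n + 2), expSum γ < expSum β →
      ∃ s, IsReduced (n + 1) s ∧ rotProd (n + 1) s = γ)
    (h : (∃ s, IsReduced (n + 1) s ∧ rotProd (n + 1) s = (phi (n + 2)).symm β) ∨
      ∃ x : BKL (n + 1), x ≠ 1 ∧ RightDvd (n + 2) (incl (n + 1) x) β) :
    ∃ s, IsReduced (n + 1) s ∧ rotProd (n + 1) s = β := by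
  obtain ⟨γ, hγ, τ, hβγ, hγ1, hτ⟩ := exists_tail_decomposition hβ
  refine exists_isReduced_of_eq_phi_mul hβ1 hβγ hγ1 ?_
  by_cases hτ1 : τ = 1
  · subst hτ1
    rcases h with h | ⟨x, hx, hxβ⟩
    · rwa [hβγ, map_one, Submonoid.coe_one, mul_one, MulEquiv.symm_apply_apply] at h
    · exact absurd (eq_one_of_rightDvd_one (hτ.2 x hxβ)) hx
  · refine ih γ hγ ?_
    have := mt eq_one_of_expSum_eq_zero hτ1
    have := expSum_nonneg τ.2
    rw [hβγ, expSum_mul, expSum_phi, coe_incl, expSum_incl]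
    omega

theorem exists_isReduced {β : ArtinBraid (n + 3)} (hβ : β ∈ BKL (n + 3)) :
    ∃ s, IsReduced (n + 2) s ∧ rotProd (n + 2) s = β := by
  induction hk : (expSum β).toNat using Nat.strong_induction_on generalizing β with
  | _ k ih =>
    by_cases hβ1 : β = 1
    · exact ⟨[], isReduced_nil, hβ1.symm⟩
    obtain ⟨j, hj⟩ := exists_rightDvd_phi_symm_iterate hβ hβ1
    induction j generalizing β with
    | zero =>
      refine exists_isReduced_of_phi_symm_or_rightDvd hβ hβ1 (fun γ hγ hlt => ?_) (.inr hj)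
      have := expSum_nonneg hγ
      exact ih _ (by omega) hγ rfl
    | succ j ihj =>
      refine exists_isReduced_of_phi_symm_or_rightDvd hβ hβ1 (fun γ hγ hlt => ?_)
        (.inl (ihj (phi_symm_mem hβ) ?_ ?_ hj))
      · have := expSum_nonneg hγ
        exact ih _ (by omega) hγ rfl
      · rw [expSum_phi_symm, hk]
      · exact mt (map_eq_one_iff _ (phi (n + 3)).symm.injective).1 hβ1

theorem exists_isSplitting (β : BKL (n + 3)) : ∃ s, IsSplitting (n + 2) β s := by
  obtain ⟨γ, hγ, τ, hβ, hγ1, -⟩ := exists_tail_decomposition β.2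
  obtain ⟨s, hs, rfl⟩ := exists_isReduced hγ
  exact ⟨s ++ [τ], isSplitting_append.2 ⟨hs, hγ1, hβ⟩⟩

end Existence

end BKL

section Shortlex

variable {α : Type*} {r : α → α → Prop} [Std.Asymm r] {x y : α}

theorem not_lex_append_singleton_between (h : ∀ z, ¬ (r x z ∧ r z y)) (s t : List α)
    (ht : t.length = s.length + 1) :
    ¬ (List.Lex r (s ++ [x]) t ∧ List.Lex r t (s ++ [y])) := by
  induction s generalizing t with
  | nil =>
    obtain ⟨z, rfl⟩ := List.length_eq_one_iff.1 ht
    rw [List.nil_append, List.nil_append, List.lex_singleton_iff, List.lex_singleton_iff]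
    exact h z
  | cons a s ih =>
    obtain ⟨b, t, rfl⟩ := List.exists_cons_of_length_eq_add_one ht
    rintro ⟨hxt, hty⟩
    cases hxt with
    | cons hxt => exact ih t (Nat.succ.inj ht) ⟨hxt, List.lex_cons_iff.1 hty⟩
    | rel hab =>
      cases hty with
      | cons => exact asymm_of r hab hab
      | rel hba => exact asymm_of r hab hba

theorem not_shortlex_append_singleton_between (h : ∀ z, ¬ (r x z ∧ r z y)) (s t : List α) :
    ¬ (List.Shortlex r (s ++ [x]) t ∧ List.Shortlex r t (s ++ [y])) := by
  simp only [List.shortlex_def, List.length_append, List.length_singleton]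
  rintro ⟨hlt | ⟨heq, hxt⟩, hgt | ⟨ht, hty⟩⟩
  · exact (hlt.trans hgt).false
  · omega
  · omega
  · exact not_lex_append_singleton_between h s t ht ⟨hxt, hty⟩

end Shortlex

namespace BKL

open ArtinBraid

section TwoStrands

theorem two_eq_powers : BKL 2 = Submonoid.powers (a 2 1 2) := by
  rw [BKL, Submonoid.powers_eq_closure]
  congr 1
  ext β
  constructor
  · rintro ⟨p, q, hp, hpq, hq, rfl⟩
    obtain rfl : p = 1 := by omega
    obtain rfl : q = 2 := by omega
    rfl
  · rintro rfl
    exact ⟨1, 2, le_rfl, one_lt_two, le_rfl, rfl⟩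

theorem exists_eq_pow (β : BKL 2) : ∃ k : ℕ, (β : ArtinBraid 2) = a 2 1 2 ^ k := by
  obtain ⟨k, hk⟩ := two_eq_powers.le β.2
  exact ⟨k, hk.symm⟩

theorem expSum_a_pow (k : ℕ) : expSum (a 2 1 2 ^ k) = k := by
  induction k with
  | zero => rw [pow_zero, expSum_one, Nat.cast_zero]
  | succ k ih => rw [pow_succ, expSum_mul, ih, expSum_a le_rfl one_lt_two le_rfl, Nat.cast_succ]

theorem rotLT_two {β γ : BKL 2} :
    RotLT 2 β γ ↔ expSum (β : ArtinBraid 2) < expSum (γ : ArtinBraid 2) := by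
  constructor
  · rintro ⟨b, c, hbc, hβ, hγ⟩
    rwa [hβ, hγ, expSum_a_pow, expSum_a_pow, Nat.cast_lt]
  · obtain ⟨b, hβ⟩ := exists_eq_pow β
    obtain ⟨c, hγ⟩ := exists_eq_pow γ
    rw [hβ, hγ, expSum_a_pow, expSum_a_pow, Nat.cast_lt]
    exact fun hbc => ⟨b, c, hbc, hβ, hγ⟩

theorem toNat_expSum_injective :
    Function.Injective fun β : BKL 2 => (expSum (β : ArtinBraid 2)).toNat := by
  intro β γ h
  obtain ⟨b, hβ⟩ := exists_eq_pow β
  obtain ⟨c, hγ⟩ := exists_eq_pow γ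
  simp only [hβ, hγ, expSum_a_pow, Int.toNat_natCast] at h
  exact Subtype.ext (by rw [hβ, hγ, h])

theorem isWellOrder_rotLT_two : IsWellOrder (BKL 2) (RotLT 2) := by
  have h : RotLT 2 = InvImage (· < ·) fun β : BKL 2 => (expSum (β : ArtinBraid 2)).toNat := by
    ext β γ
    have := expSum_nonneg β.2
    rw [rotLT_two, InvImage]
    omega
  rw [h]
  exact { wf := InvImage.wf _ wellFounded_lt
          trichotomous := (InvImage.trichotomous toNat_expSum_injective).trichotomous }

end TwoStrands

section Splitting

variable {n : ℕ} {β γ : BKL (n + 3)}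

/-- The `φ_{n+3}`-splitting of an element of `BKL_{n+3}`. -/
noncomputable def splitting (β : BKL (n + 3)) : List (BKL (n + 2)) := (exists_isSplitting β).choose

theorem isSplitting_splitting (β : BKL (n + 3)) : IsSplitting (n + 2) β (splitting β) :=
  (exists_isSplitting β).choose_spec

theorem IsSplitting.splitting_eq {s : List (BKL (n + 2))} (h : IsSplitting (n + 2) β s) :
    splitting β = s := (isSplitting_splitting β).unique h

theorem splitting_injective : Function.Injective (splitting (n := n)) := by
  intro β γ h
  apply Subtype.ext
  rw [(isSplitting_splitting β).2.2.1, h, ← (isSplitting_splitting γ).2.2.1]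

theorem hasBreadth_iff {b : ℕ} : HasBreadth (n + 2) β b ↔ (splitting β).length = b := by
  refine ⟨?_, fun h => ⟨_, isSplitting_splitting β, h⟩⟩
  rintro ⟨s, hs, rfl⟩
  rw [hs.splitting_eq]

theorem rotLT_iff :
    RotLT (n + 3) β γ ↔ List.Shortlex (RotLT (n + 2)) (splitting β) (splitting γ) := by
  refine ⟨?_, fun h => ⟨_, _, isSplitting_splitting β, isSplitting_splitting γ, h⟩⟩
  rintro ⟨s, t, hs, ht, h⟩
  rwa [hs.splitting_eq, ht.splitting_eq]

theorem isWellOrder_rotLT (n : ℕ) : IsWellOrder (BKL (n + 2)) (RotLT (n + 2)) := by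
  induction n with
  | zero => exact isWellOrder_rotLT_two
  | succ n ih =>
    have h : RotLT (n + 3) = InvImage (List.Shortlex (RotLT (n + 2))) splitting := by
      ext β γ
      exact rotLT_iff
    rw [h]
    exact { wf := InvImage.wf _ (List.Shortlex.wf ih.wf)
            trichotomous := (InvImage.trichotomous splitting_injective).trichotomous }

end Splitting

section Successor

variable {n : ℕ}

/-- The generator `a_{1,2}` of `BKL_{n+2}`. -/
abbrev genFirst (n : ℕ) : BKL (n + 2) := gen (n + 2) 1 2 le_rfl one_lt_two (by omega)

theorem incl_genFirst (n : ℕ) : incl (n + 2) (genFirst n) = genFirst (n + 1) :=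
  Subtype.ext (incl_a (n + 2) le_rfl one_lt_two (by omega))

theorem expSum_mul_genFirst (β : BKL (n + 2)) :
    expSum (↑(β * genFirst n) : ArtinBraid (n + 2)) = expSum (β : ArtinBraid (n + 2)) + 1 := by
  have h : expSum (genFirst n : ArtinBraid (n + 2)) = 1 := expSum_a le_rfl one_lt_two (by omega)
  rw [Submonoid.coe_mul, expSum_mul, h]

theorem IsSplitting.mul_genFirst {β : BKL (n + 3)} {s : List (BKL (n + 2))} {x : BKL (n + 2)}
    (h : IsSplitting (n + 2) β (s ++ [x])) :
    IsSplitting (n + 2) (β * genFirst (n + 1)) (s ++ [x * genFirst n]) := by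
  obtain ⟨hs, hs1, hβ⟩ := isSplitting_append.1 h
  refine isSplitting_append.2 ⟨hs, hs1, ?_⟩
  rw [← incl_genFirst, Submonoid.coe_mul, hβ, map_mul, Submonoid.coe_mul, mul_assoc]

theorem rotLT_mul_genFirst (n : ℕ) (β : BKL (n + 2)) : RotLT (n + 2) β (β * genFirst n) := by
  induction n with
  | zero =>
    refine rotLT_two.2 ?_
    rw [expSum_mul_genFirst]
    exact lt_add_one _
  | succ n ih =>
    obtain ⟨s, x, hs⟩ := (isSplitting_splitting β).exists_eq_append
    have hβ := isSplitting_splitting β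
    rw [hs] at hβ
    refine rotLT_iff.2 ?_
    rw [hβ.mul_genFirst.splitting_eq, hs]
    exact .append_left ((List.shortlex_singleton_iff _ _).2 (ih x)) s

theorem not_rotLT_between_mul_genFirst (n : ℕ) (β γ : BKL (n + 2)) :
    ¬ (RotLT (n + 2) β γ ∧ RotLT (n + 2) γ (β * genFirst n)) := by
  induction n with
  | zero =>
    rintro ⟨hβγ, hγβ⟩
    have hlt := rotLT_two.1 hβγ
    have hgt := rotLT_two.1 hγβ
    rw [expSum_mul_genFirst] at hgt
    omega
  | succ n ih =>
    have := isWellOrder_rotLT n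
    obtain ⟨s, x, hs⟩ := (isSplitting_splitting β).exists_eq_append
    have hβ := isSplitting_splitting β
    rw [hs] at hβ
    rw [rotLT_iff, rotLT_iff, hβ.mul_genFirst.splitting_eq, hs]
    exact not_shortlex_append_singleton_between (ih x) s _

end Successor

section InitialSegment

variable {n : ℕ}

theorem isTail_one (n : ℕ) : IsTail n 1 1 := by
  refine ⟨⟨1, one_mem _, by rw [map_one, Submonoid.coe_one, mul_one]⟩, fun y hy => ?_⟩
  have h := eq_one_of_rightDvd_one (x := incl n y) hy
  rw [incl_injective (h.trans (map_one (incl n)).symm)]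
  exact .refl _

theorem isTail_phi_rotProd_nil (n : ℕ) : IsTail n (phi (n + 1) (rotProd n [])) 1 := by
  rw [rotProd, map_one]
  exact isTail_one n

theorem splitting_incl (β : BKL (n + 2)) : splitting (incl (n + 2) β) = [β] :=
  IsSplitting.splitting_eq ((isSplitting_append (s := [])).2
    ⟨isReduced_nil, isTail_phi_rotProd_nil _, by rw [rotProd, map_one, one_mul]⟩)

theorem length_splitting_eq_one_iff {β : BKL (n + 3)} :
    (splitting β).length = 1 ↔ ∃ x, incl (n + 2) x = β := by
  rw [List.length_eq_one_iff]
  refine exists_congr fun x => ⟨fun h => splitting_injective ?_, ?_⟩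
  · rw [splitting_incl, h]
  · rintro rfl
    exact splitting_incl x

theorem rotLT_incl {β γ : BKL (n + 2)} :
    RotLT (n + 3) (incl (n + 2) β) (incl (n + 2) γ) ↔ RotLT (n + 2) β γ := by
  rw [rotLT_iff, splitting_incl, splitting_incl, List.shortlex_singleton_iff]

theorem exists_incl_eq_of_rotLT_incl {β : BKL (n + 3)} {γ : BKL (n + 2)}
    (h : RotLT (n + 3) β (incl (n + 2) γ)) : ∃ x, incl (n + 2) x = β := by
  have hpos := List.length_pos_iff.2 (isSplitting_splitting β).1
  rw [rotLT_iff, splitting_incl, List.shortlex_def, List.length_singleton] at h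
  exact length_splitting_eq_one_iff.1 (by omega)

theorem not_rotLT_one (n : ℕ) (β : BKL (n + 2)) : ¬ RotLT (n + 2) β 1 := by
  induction n with
  | zero =>
    intro h
    have h := rotLT_two.1 h
    rw [Submonoid.coe_one, expSum_one] at h
    exact h.not_ge (expSum_nonneg β.2)
  | succ n ih =>
    intro h
    rw [← map_one (incl (n + 2))] at h
    obtain ⟨x, rfl⟩ := exists_incl_eq_of_rotLT_incl h
    exact ih x (rotLT_incl.1 h)

/-- The generator `a_{n+1,n+2}` of `BKL_{n+2}`, which bounds the image of `BKL_{n+1}`. -/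
abbrev genLast (n : ℕ) : BKL (n + 2) :=
  gen (n + 2) (n + 1) (n + 2) (by omega) (by omega) le_rfl

theorem expSum_genLast (n : ℕ) : expSum (genLast n : ArtinBraid (n + 2)) = 1 :=
  expSum_a (by omega) (by omega) le_rfl

theorem genLast_ne_one (n : ℕ) : genLast n ≠ 1 := fun h => by
  have hsum := expSum_genLast n
  rw [h, Submonoid.coe_one, expSum_one] at hsum
  exact zero_ne_one hsum

theorem isTail_genLast (n : ℕ) : IsTail (n + 1) (genLast n) 1 := by
  refine ⟨⟨_, (genLast n).2, by rw [map_one, Submonoid.coe_one, mul_one]⟩, ?_⟩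
  rintro y ⟨γ, hγ, h⟩
  have hsum := expSum_genLast n
  rw [h, expSum_mul, coe_incl, expSum_incl] at hsum
  by_cases hy : expSum (y : ArtinBraid (n + 1)) = 0
  · rw [eq_one_of_expSum_eq_zero hy]
    exact .refl _
  · have := expSum_nonneg hγ
    have := expSum_nonneg y.2
    rw [(expSum_eq_zero_iff hγ).1 (by omega), one_mul, coe_incl] at h
    exact absurd ((a_succ_self (n + 1)).symm.trans h) (sigma_last_ne_incl (by omega) _)

theorem phi_incl_genLast (n : ℕ) :
    phi (n + 3) (incl (n + 2) (genLast n)) = (genLast (n + 1) : ArtinBraid (n + 3)) := by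
  have h : (incl (n + 2) (genLast n) : ArtinBraid (n + 3)) = a (n + 3) (n + 1) (n + 2) :=
    incl_a (n + 2) (by omega) (by omega) le_rfl
  rw [h, phi_a (by omega) (by omega) (by omega)]
  rfl

theorem rotProd_singleton (x : BKL n) : rotProd n [x] = incl n x := by
  rw [rotProd, rotProd, mul_one, List.length_nil, pow_zero, MulAut.one_apply]

theorem splitting_genLast (n : ℕ) : splitting (genLast (n + 1)) = [genLast n, 1] := by
  have hrot : phi (n + 3) (rotProd (n + 2) [genLast n]) =
      (genLast (n + 1) : ArtinBraid (n + 3)) := by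
    rw [rotProd_singleton, phi_incl_genLast]
  refine IsSplitting.splitting_eq ((isSplitting_append (s := [_])).2 ⟨?_, ?_, ?_⟩)
  · exact (isReduced_append (s := [])).2
      ⟨isReduced_nil, isTail_phi_rotProd_nil _, fun _ => genLast_ne_one n⟩
  · rw [hrot]
    exact isTail_genLast (n + 1)
  · rw [hrot, map_one, Submonoid.coe_one, mul_one]

theorem hasBreadth_genLast (n : ℕ) : HasBreadth (n + 2) (genLast (n + 1)) 2 := by
  rw [hasBreadth_iff, splitting_genLast]
  rfl

theorem rotLT_incl_genLast (x : BKL (n + 2)) :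
    RotLT (n + 3) (incl (n + 2) x) (genLast (n + 1)) := by
  rw [rotLT_iff, splitting_incl, splitting_genLast]
  exact .of_length_lt (Nat.lt_succ_self 1)

theorem exists_phi_incl_incl_eq (x : BKL n) :
    ∃ y : BKL (n + 1), phi (n + 2) (incl (n + 1) (incl n x)) = incl (n + 1) y := by
  have hle : BKL n ≤ ((BKL (n + 1)).map (ArtinBraid.incl (n + 1))).comap
      ((phi (n + 2)).toMonoidHom.comp ((ArtinBraid.incl (n + 1)).comp (ArtinBraid.incl n))) := by
    refine Submonoid.closure_le.2 ?_
    rintro _ ⟨p, q, hp, hpq, hq, rfl⟩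
    refine ⟨a (n + 1) (p + 1) (q + 1),
      Submonoid.subset_closure ⟨_, _, by omega, by omega, by omega, rfl⟩, ?_⟩
    change _ = phi (n + 2) (ArtinBraid.incl (n + 1) (ArtinBraid.incl n (a n p q)))
    rw [incl_a n hp hpq hq, incl_a (n + 1) hp hpq (by omega), phi_a hp hpq (by omega),
      incl_a (n + 1) (by omega) (by omega) (by omega)]
  obtain ⟨y, hy, h⟩ := hle x.2
  exact ⟨⟨y, hy⟩, h.symm⟩

theorem eq_one_of_isTail_phi_incl_incl {x : BKL n}
    (h : IsTail (n + 1) (phi (n + 2) (incl (n + 1) (incl n x))) 1) : x = 1 := by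
  obtain ⟨y, hy⟩ := exists_phi_incl_incl_eq x
  have hy1 : y = 1 := eq_one_of_rightDvd_one (h.2 y (by rw [hy]; exact .refl _))
  rw [hy1, map_one, Submonoid.coe_one, map_eq_one_iff _ (phi (n + 2)).injective] at hy
  exact (map_eq_one_iff _ incl_injective).1 <|
    (map_eq_one_iff _ incl_injective).1 <| Subtype.ext hy

theorem exists_incl_eq_of_forall_eq_one {β : BKL (n + 3)}
    (h : RotLT (n + 3) β (genLast (n + 1)))
    (eq_one : ∀ x : BKL (n + 2), RotLT (n + 2) x (genLast n) →
      IsTail (n + 2) (phi (n + 3) (incl (n + 2) x)) 1 → x = 1) :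
    ∃ x, incl (n + 2) x = β := by
  have hβ := isSplitting_splitting β
  have hpos := List.length_pos_iff.2 hβ.1
  rw [rotLT_iff, splitting_genLast] at h
  refine length_splitting_eq_one_iff.1 ?_
  rcases List.shortlex_def.1 h with hlt | ⟨hlen, hlex⟩
  · exact (Nat.le_of_lt_succ hlt).antisymm hpos
  · obtain ⟨y, x, hs⟩ := List.length_eq_two.1 hlen
    rw [hs] at hlex hβ
    obtain ⟨hy, hy1, -⟩ := (isSplitting_append (s := [y])).1 hβ
    rw [rotProd_singleton] at hy1
    refine absurd (eq_one y ?_ hy1) ((isReduced_append (s := [])).1 hy |>.2.2 rfl)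
    cases hlex with
    | cons hx1 => exact absurd ((List.lex_singleton_iff x 1).1 hx1) (not_rotLT_one n x)
    | rel hy => exact hy

theorem eq_one_of_rotLT_genLast_of_isTail (n : ℕ) (x : BKL (n + 2))
    (hx : RotLT (n + 2) x (genLast n))
    (htail : IsTail (n + 2) (phi (n + 3) (incl (n + 2) x)) 1) : x = 1 := by
  induction n with
  | zero =>
    have hlt := rotLT_two.1 hx
    have hnonneg := expSum_nonneg x.2
    have h1 := expSum_genLast 0
    refine eq_one_of_expSum_eq_zero ?_
    omega
  | succ n ih =>
    obtain ⟨y, rfl⟩ := exists_incl_eq_of_forall_eq_one hx ih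
    rw [eq_one_of_isTail_phi_incl_incl htail, map_one]

theorem range_incl_eq (n : ℕ) :
    Set.range (incl (n + 2)) = {β | RotLT (n + 3) β (genLast (n + 1))} := by
  ext β
  constructor
  · rintro ⟨x, rfl⟩
    exact rotLT_incl_genLast x
  · exact fun h => exists_incl_eq_of_forall_eq_one h (eq_one_of_rotLT_genLast_of_isTail n)

theorem eq_genLast_or_rotLT_of_hasBreadth_two {β : BKL (n + 3)} (h : HasBreadth (n + 2) β 2) :
    β = genLast (n + 1) ∨ RotLT (n + 3) (genLast (n + 1)) β := by
  have := isWellOrder_rotLT (n + 1)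
  rcases trichotomous_of (RotLT (n + 3)) β (genLast (n + 1)) with hlt | heq | hgt
  · obtain ⟨x, rfl⟩ := (range_incl_eq n).ge hlt
    rw [hasBreadth_iff, splitting_incl, List.length_singleton] at h
    exact absurd h one_lt_two.ne
  · exact .inl heq
  · exact .inr hgt

end InitialSegment

end BKL

theorem mainTheorem7 (n : ℕ) (hn : 2 ≤ n) :
    -- `<*` is a well-ordering on `BKL_n`
    IsWellOrder (BKL n) (BKL.RotLT n) ∧
    -- the immediate successor of `β` is `β a_{1,2} = β σ_1`
    (BKL.gen n 1 2 le_rfl one_lt_two hn : ArtinBraid n) = ArtinBraid.sigma n 1 ∧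
    (∀ β : BKL n,
      BKL.RotLT n β (β * BKL.gen n 1 2 le_rfl one_lt_two hn) ∧
      ∀ γ : BKL n, ¬ (BKL.RotLT n β γ ∧
        BKL.RotLT n γ (β * BKL.gen n 1 2 le_rfl one_lt_two hn))) ∧
    -- `BKL_n` embeds in `BKL_{n+1}`, compatibly with the rotating relations
    Function.Injective (BKL.incl n) ∧
    (∀ β γ : BKL n, BKL.RotLT (n + 1) (BKL.incl n β) (BKL.incl n γ) ↔ BKL.RotLT n β γ) ∧
    -- its image is the initial segment of `BKL_{n+1}` determined by `a_{n,n+1}`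
    Set.range (BKL.incl n) =
      {β : BKL (n + 1) | BKL.RotLT (n + 1) β
        (BKL.gen (n + 1) n (n + 1) (one_le_two.trans hn) n.lt_succ_self le_rfl)} ∧
    -- `a_{n,n+1}` is the least braid of `(n+1)`-breadth `2`
    BKL.HasBreadth n
      (BKL.gen (n + 1) n (n + 1) (one_le_two.trans hn) n.lt_succ_self le_rfl) 2 ∧
    (∀ β : BKL (n + 1), BKL.HasBreadth n β 2 →
      β = BKL.gen (n + 1) n (n + 1) (one_le_two.trans hn) n.lt_succ_self le_rfl ∨
      BKL.RotLT (n + 1)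
        (BKL.gen (n + 1) n (n + 1) (one_le_two.trans hn) n.lt_succ_self le_rfl) β) := by
  obtain ⟨n, rfl⟩ := Nat.exists_eq_add_of_le' hn
  exact ⟨BKL.isWellOrder_rotLT n, ArtinBraid.a_succ_self 1,
    fun β => ⟨BKL.rotLT_mul_genFirst n β, BKL.not_rotLT_between_mul_genFirst n β⟩,
    BKL.incl_injective, fun _ _ => BKL.rotLT_incl, BKL.range_incl_eq n,
    BKL.hasBreadth_genLast n, fun _ => BKL.eq_genLast_or_rotLT_of_hasBreadth_two⟩
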